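/- Let $n>1$ and let $\Omega=\{z\in\mathbb C^n: r(z)<0\}$ be a non-empty bounded domain of finite type $M$, where $r:\mathbb C^n\to\mathbb R$ is smooth and everywhere convex, with (real) gradient satisfying $|\nabla r|=1$ on the boundary $b\Omega$. Here the type of $p\in b\Omega$ is the supremum of the orders of contact at $p$ of $b\Omega$ with germs of non-singular complex analytic sets of positive dimension, and $M$ is the supremum of the types of the boundary points. *Polydiscs.* For $\xi\in\mathbb C^n$, $u\in\mathbb C^n$ and $\varepsilon>0$ put $\tau(\xi,u,\varepsilon)=\sup\{c>0: |r(\xi+\lambda u)-r(\xi)|\le\varepsilon \text{ for all }\lambda\in\mathbb C,\ |\lambda|\le c\}$. An $\varepsilon$-extremal basis at $\xi$ is an orthonormal basis $u_1,\dots,u_n$ of $\mathbb C^n$ such that $u_1=(q_1-\xi)/|q_1-\xi|$ for some point $q_1$ on the line $\xi+\mathbb R\,\nabla r(\xi)$ with $r(q_1)=r(\xi)+\varepsilon$ and, for $k\ge2$, $u_k$ maximizes the distance from $\xi$ to the level set $\{r=r(\xi)+\varepsilon\}$ along the complex line $\xi+\mathbb C u$, among all unit vectors $u$ orthogonal to $u_1,\dots,u_{k-1}$.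 Choose such a basis for every $\xi\in b\Omega$ and $\varepsilon>0$, and let $P_\varepsilon(\xi)=\{\xi+\sum_k\lambda_ku_k: |\lambda_k|\le\tau(\xi,u_k,\varepsilon),\ 1\le k\le n\}$. *Projections.* Let $U$ be a neighborhood of $b\Omega$ such that every $z\in\Omega\cap U$ has a unique nearest point $\Pi(z)$ in $b\Omega$, and $\frac23\le|\nabla r|\le\frac32$ on $U$. Let $V\subseteq U$ be a neighborhood of $b\Omega$, $t_0>0$, and let $\varphi:V\times[0,t_0)\to U$ be the flow $\partial_t\varphi(x,t)=-\frac{\nabla r}{|\nabla r|^2}(\varphi(x,t))$, $\varphi(x,0)=x$. For $z\in\Omega\cap V$, let $\Pi^{flow}(z)$ be the point $p\in b\Omega$ with $\varphi(p,-r(z))=z$ (where $-r(z)<t_0$ and such a $p$ exists). *Tents.* For $\zeta\in b\Omega$ and $\varepsilon>0$ let $$T_\varepsilon(\zeta)=\{z\in\Omega\cap U:\Pi(z)\in P_\varepsilon(\zeta)\cap b\Omega,\ r(z)\in(-\varepsilon,0)\},$$ $$T^{flow}_\varepsilon(\zeta)=\{z\in\Omega\cap V:\Pi^{flow}(z)\in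 P_\varepsilon(\zeta)\cap b\Omega,\ r(z)\in(-\varepsilon,0)\}.$$ *Dyadic grids.* Let $\rho(\zeta,\eta)=\inf\{\varepsilon>0:\zeta\in P_\varepsilon(\eta),\ \eta\in P_\varepsilon(\zeta)\}$ for $\zeta,\eta\in b\Omega$, and $B(\zeta,\varepsilon)=\{\eta\in b\Omega:\rho(\eta,\zeta)<\varepsilon\}$. A dyadic grid is a family $\mathcal D=\bigcup_{k\ge1}\mathcal D_k$ of subsets of $b\Omega$ with centers $c(Q)\in b\Omega$ and constants $\mathfrak C>1$, $0<\delta,\epsilon<1$ such that: (1) $b\Omega=\bigcup_{Q\in\mathcal D_k}Q$ for all $k\ge1$; (2) two cubes that meet are nested; (3) each $Q\in\mathcal D_k$ contains some $Q'\in\mathcal D_{k+1}$ (a child of $Q$); (4) each $Q\in\mathcal D_{k+1}$ lies in exactly one element of $\mathcal D_k$; (5) $\sigma(Q')\ge\epsilon\,\sigma(Q)$ if $Q'$ is a child of $Q$, where $\sigma$ is surface measure; (6) $B(c(Q),\delta^k)\subseteq Q\subseteq B(c(Q),\mathfrak C\delta^k)$ for $Q\in\mathcal D_k$. For $Q\in\mathcal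 D_k$ put $\ell(Q)=\delta^k$ and $$T_d^{proj}(Q)=\{z\in\Omega\cap U:\Pi(z)\in Q,\ r(z)\in(-\ell(Q),0)\},\qquad T_d^{flow}(Q)=\{z\in\Omega\cap V:\Pi^{flow}(z)\in Q,\ r(z)\in(-\ell(Q),0)\}.$$ **Theorem.** There are constants $C_1>1$, depending only on $r$ and $n$, and $\tau_2>0$, depending only on $r$, $n$ and the fixed $U$, $V$, $t_0$ (not on the choice of extremal bases), such that for all $0<\varepsilon<\tau_2$ and all $\zeta\in b\Omega$ $$T^{flow}_\varepsilon(\zeta)\subseteq T_{C_1\varepsilon}(\zeta)\quad\text{and}\quad T_\varepsilon(\zeta)\subseteq T^{flow}_{C_1\varepsilon}(\zeta).$$ Moreover, with the same constants, for every dyadic grid $\mathcal D$ and every $Q\in\mathcal D$ with $\ell(Q)\le\tau_2/\mathfrak C$, $$T_d^{proj}(Q)\subseteq T^{flow}_{\mathfrak CC_1\ell(Q)}(c(Q))\quad\text{and}\quad T_d^{flow}(Q)\subseteq T_{\mathfrak CC_1\ell(Q)}(c(Q)).$$ -/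

import Mathlib

open Set Filter Topology Asymptotics
open scoped ENNReal ContDiff

noncomputable section

namespace FlowTents

/-- Complex Euclidean space of dimension n. -/
abbrev Cn (n : ℕ) := EuclideanSpace ℂ (Fin n)

variable {n : ℕ}

/-- The domain defined by r. -/
def dom (r : Cn n → ℝ) : Set (Cn n) := {z | r z < 0}

/-- The boundary of the domain defined by r. -/
def bd (r : Cn n → ℝ) : Set (Cn n) := frontier (dom r)

/-! ### Finite type -/

/-- The order of contact of the hypersurface r = 0 with the germ at F 0 of the complex manifold
parametrized by F near 0: the supremum of all s such that r (F w) = O(‖w‖ ^ s) as w tends to 0. -/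
def contactOrder (r : Cn n → ℝ) {d : ℕ} (F : Cn d → Cn n) : ℕ∞ :=
  ⨆ (s : ℕ) (_ : (fun w => r (F w)) =O[𝓝 0] (fun w => ‖w‖ ^ s)), (s : ℕ∞)

/-- F parametrizes near 0 a germ at p of a nonsingular complex analytic set of dimension d ≥ 1. -/
def IsNonsingularGerm {d : ℕ} (p : Cn n) (F : Cn d → Cn n) : Prop :=
  0 < d ∧ AnalyticAt ℂ F 0 ∧ F 0 = p ∧ Function.Injective (fderiv ℂ F 0)

/-- The type of p: the supremum of the orders of contact with germs at p of nonsingular complex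
analytic sets (of positive dimension). -/
def pointType (r : Cn n → ℝ) (p : Cn n) : ℕ∞ :=
  ⨆ (d : ℕ) (F : Cn d → Cn n) (_ : IsNonsingularGerm p F), contactOrder r F

/-- The type of the domain: the supremum of the types of the boundary points. -/
def domainType (r : Cn n → ℝ) : ℕ∞ := ⨆ p ∈ bd r, pointType r p

/-- The domain defined by r is a smoothly bounded convex domain of finite type M, and r is a
smooth, everywhere convex defining function, with gradient of length one on the boundary. The
gradient is the real one, for the underlying real Euclidean space of dimension 2n. -/
structure IsConvexFiniteType (r : Cn n → ℝ) (M : ℕ) : Prop where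
  smooth : ContDiff ℝ ∞ r
  convex : ConvexOn ℝ univ r
  nonempty : (dom r).Nonempty
  bounded : Bornology.IsBounded (dom r)
  grad_bd : ∀ z ∈ bd r, ‖gradient r z‖ = 1
  type_eq : domainType r = (M : ℕ∞)

/-! ### Extremal bases and the polydiscs -/

/-- The supremum of the radii c > 0 with |r(ξ + λ v) - r(ξ)| ≤ ε for all complex λ, |λ| ≤ c. -/
def tau (r : Cn n → ℝ) (ξ v : Cn n) (ε : ℝ) : ℝ :=
  sSup {c : ℝ | 0 < c ∧ ∀ l : ℂ, ‖l‖ ≤ c → |r (ξ + l • v) - r ξ| ≤ ε}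

/-- The distance from ξ to the level set r = r(ξ) + ε along the complex line ξ + ℂ v. -/
def lineDist (r : Cn n → ℝ) (ξ v : Cn n) (ε : ℝ) : ℝ :=
  Metric.infDist ξ {z | r z = r ξ + ε ∧ ∃ l : ℂ, z = ξ + l • v}

/-- u is an ε-extremal basis at ξ: it is orthonormal, the first vector points from ξ to a point of
the level set r = r(ξ) + ε on the line through ξ in the direction of the gradient, and every
further vector maximizes the distance to this level set along complex lines, among all unit
vectors that are complex-orthogonal to the preceding ones. -/
structure IsExtremalBasis (r : Cn n → ℝ) (ξ : Cn n) (ε : ℝ) (u : Fin n → Cn n) : Prop where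
  orthonormal : Orthonormal ℂ u
  first : ∀ k : Fin n, k.val = 0 → ∃ q : Cn n, (∃ t : ℝ, q = ξ + t • gradient r ξ) ∧
    r q = r ξ + ε ∧ u k = ‖q - ξ‖⁻¹ • (q - ξ)
  next : ∀ k : Fin n, 0 < k.val → ∀ v : Cn n, ‖v‖ = 1 → (∀ j < k, inner ℂ (u j) v = 0) →
    lineDist r ξ v ε ≤ lineDist r ξ (u k) ε

/-- A choice of extremal bases at all boundary points and all scales. -/
def IsExtremalChoice (r : Cn n → ℝ) (u : Cn n → ℝ → Fin n → Cn n) : Prop :=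
  ∀ ξ ∈ bd r, ∀ ε : ℝ, 0 < ε → IsExtremalBasis r ξ ε (u ξ ε)

/-- The polydisc P_ε(ξ) for the chosen ε-extremal basis at ξ. -/
def polydisc (r : Cn n → ℝ) (u : Cn n → ℝ → Fin n → Cn n) (ξ : Cn n) (ε : ℝ) : Set (Cn n) :=
  {z | ∃ l : Fin n → ℂ, (∀ k, ‖l k‖ ≤ tau r ξ (u ξ ε k) ε) ∧ z = ξ + ∑ k, l k • u ξ ε k}

/-! ### The quasi-metric and dyadic grids on the boundary -/

/-- The infimum of all ε > 0 such that each point lies in the polydisc of size ε at the other. -/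
def rho (r : Cn n → ℝ) (u : Cn n → ℝ → Fin n → Cn n) (ζ η : Cn n) : ℝ≥0∞ :=
  ⨅ (ε : ℝ) (_ : 0 < ε ∧ ζ ∈ polydisc r u η ε ∧ η ∈ polydisc r u ζ ε), ENNReal.ofReal ε

/-- The ball in the boundary for the quasi-metric. -/
def rhoBall (r : Cn n → ℝ) (u : Cn n → ℝ → Fin n → Cn n) (ζ : Cn n) (ε : ℝ) : Set (Cn n) :=
  {η ∈ bd r | rho r u η ζ < ENNReal.ofReal ε}

/-- Surface measure on the boundary, as Hausdorff measure of dimension 2n - 1 (up to a constant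
normalizing factor, which is irrelevant to the doubling-type comparison where it is used). -/
def surfaceMeasure (r : Cn n → ℝ) : MeasureTheory.Measure (Cn n) :=
  (MeasureTheory.Measure.hausdorffMeasure (2 * (n : ℝ) - 1)).restrict (bd r)

/-- The families D k (k ≥ 1) form a dyadic grid of the boundary, with centers c k Q, sidelengths
δ ^ k, and parameters C (outer constant) and ϵ (proportion of a child). -/
structure IsDyadicGrid (r : Cn n → ℝ) (u : Cn n → ℝ → Fin n → Cn n)
    (D : ℕ → Set (Set (Cn n))) (c : ℕ → Set (Cn n) → Cn n) (C δ ϵ : ℝ) : Prop where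
  one_lt_C : 1 < C
  δ_pos : 0 < δ
  δ_lt_one : δ < 1
  ϵ_pos : 0 < ϵ
  ϵ_lt_one : ϵ < 1
  cover : ∀ k, 1 ≤ k → ⋃₀ D k = bd r
  nested : ∀ j k, 1 ≤ j → 1 ≤ k → ∀ Q₁ ∈ D j, ∀ Q₂ ∈ D k, (Q₁ ∩ Q₂).Nonempty →
    Q₁ ⊆ Q₂ ∨ Q₂ ⊆ Q₁
  child : ∀ k, 1 ≤ k → ∀ Q ∈ D k, ∃ Q' ∈ D (k + 1), Q' ⊆ Q
  parent : ∀ k, 1 ≤ k → ∀ Q ∈ D (k + 1), ∃! Q', Q' ∈ D k ∧ Q ⊆ Q'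
  child_measure : ∀ k, 1 ≤ k → ∀ Q ∈ D k, ∀ Q' ∈ D (k + 1), Q' ⊆ Q →
    ENNReal.ofReal ϵ * surfaceMeasure r Q ≤ surfaceMeasure r Q'
  center_mem : ∀ k, 1 ≤ k → ∀ Q ∈ D k, c k Q ∈ bd r
  sandwich : ∀ k, 1 ≤ k → ∀ Q ∈ D k,
    rhoBall r u (c k Q) (δ ^ k) ⊆ Q ∧ Q ⊆ rhoBall r u (c k Q) (C * δ ^ k)

/-! ### The two projections -/

/-- p is a nearest boundary point of z. -/
def IsNearest (r : Cn n → ℝ) (z p : Cn n) : Prop :=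
  p ∈ bd r ∧ dist z p = Metric.infDist z (bd r)

/-- U is a neighborhood of the boundary, so small that the nearest-point projection is well
defined on the part of U inside the domain, and that the gradient has length between 2/3 and 3/2
on U. -/
structure IsAdmissibleNhd (r : Cn n → ℝ) (U : Set (Cn n)) : Prop where
  nhd : U ∈ 𝓝ˢ (bd r)
  proj : ∀ z ∈ dom r ∩ U, ∃! p, IsNearest r z p
  grad : ∀ z ∈ U, 2 / 3 ≤ ‖gradient r z‖ ∧ ‖gradient r z‖ ≤ 3 / 2

/-- φ is the flow of the vector field -∇r/|∇r|², on V for the times in [0, t₀), with values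
in U. -/
structure IsNormalFlow (r : Cn n → ℝ) (U V : Set (Cn n)) (t₀ : ℝ) (φ : Cn n → ℝ → Cn n) :
    Prop where
  nhd : V ∈ 𝓝ˢ (bd r)
  sub : V ⊆ U
  time_pos : 0 < t₀
  init : ∀ x ∈ V, φ x 0 = x
  mem : ∀ x ∈ V, ∀ t ∈ Ico 0 t₀, φ x t ∈ U
  ode : ∀ x ∈ V, ∀ t ∈ Ico 0 t₀,
    HasDerivWithinAt (φ x) (-((‖gradient r (φ x t)‖ ^ 2)⁻¹ • gradient r (φ x t))) (Ico 0 t₀) t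

/-- p is the boundary point from which the flow reaches z at the time -r(z), that is, p is the
projection of z along the flow lines. -/
def IsFlowProj (r : Cn n → ℝ) (t₀ : ℝ) (φ : Cn n → ℝ → Cn n) (z p : Cn n) : Prop :=
  p ∈ bd r ∧ -r z ∈ Ico 0 t₀ ∧ φ p (-r z) = z

/-! ### Tents -/

/-- The projection tent of height s over a subset S of the boundary. -/
def projTent (r : Cn n → ℝ) (U : Set (Cn n)) (S : Set (Cn n)) (s : ℝ) : Set (Cn n) :=
  {z | z ∈ dom r ∩ U ∧ (∃ p ∈ S, IsNearest r z p) ∧ r z ∈ Ioo (-s) 0}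

/-- The flow tent of height s over a subset S of the boundary. -/
def flowTent (r : Cn n → ℝ) (V : Set (Cn n)) (t₀ : ℝ) (φ : Cn n → ℝ → Cn n)
    (S : Set (Cn n)) (s : ℝ) : Set (Cn n) :=
  {z | z ∈ dom r ∩ V ∧ (∃ p ∈ S, IsFlowProj r t₀ φ z p) ∧ r z ∈ Ioo (-s) 0}

/-- The projection tent T_ε(ζ). -/
def projTentAt (r : Cn n → ℝ) (u : Cn n → ℝ → Fin n → Cn n) (U : Set (Cn n))
    (ζ : Cn n) (ε : ℝ) : Set (Cn n) :=
  projTent r U (polydisc r u ζ ε ∩ bd r) ε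

/-- The flow tent T^flow_ε(ζ). -/
def flowTentAt (r : Cn n → ℝ) (u : Cn n → ℝ → Fin n → Cn n) (V : Set (Cn n)) (t₀ : ℝ)
    (φ : Cn n → ℝ → Cn n) (ζ : Cn n) (ε : ℝ) : Set (Cn n) :=
  flowTent r V t₀ φ (polydisc r u ζ ε ∩ bd r) ε

end FlowTents

end

/-!
For a convex function, the body of all displacements `w` along whose complex disc `r` grows by at
most `ε` is convex and balanced, and up to dilation by constants it is the polydisc `P_ε`, for every
extremal basis. Finite type bounds the Taylor polynomials of `r` on complex lines from below,
uniformly on the compact boundary, so that a dilation of this body by a fixed factor is absorbed by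
raising `ε` by a fixed factor, and the body contains a Euclidean ball of radius comparable to `ε`.
Hence a Euclidean perturbation of size `O(ε)` of a point of `P_ε(ζ)` stays in `P_{Cε}(ζ)`. Both
projections move a point `z` by `O(-r(z))`, and this gives all four inclusions.
-/

open scoped Pointwise

noncomputable section

namespace FlowTents

/-! ### Growth bodies -/

section GrowthBody

/-- The body of all displacements w such that r exceeds r(ξ) by at most ε on the complex disc
{ξ + λ w : |λ| ≤ 1}. For convex r and small ε it is comparable, up to constant dilations, to the
translated polydisc P_ε(ξ) - ξ, but unlike the polydisc it depends on no choice of a basis. -/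
def growthBody {E : Type*} [AddCommGroup E] [Module ℂ E] (r : E → ℝ) (ξ : E) (ε : ℝ) : Set E :=
  {w | ∀ l : ℂ, ‖l‖ ≤ 1 → r (ξ + l • w) ≤ r ξ + ε}

section Module

variable {E : Type*} [AddCommGroup E] [Module ℂ E] {r : E → ℝ} {ξ w : E} {ε ε' : ℝ}

lemma zero_mem_growthBody (hε : 0 ≤ ε) : (0 : E) ∈ growthBody r ξ ε := fun l _ => by
  simpa using hε

lemma growthBody_mono (h : ε ≤ ε') : growthBody r ξ ε ⊆ growthBody r ξ ε' :=
  fun _ hw l hl => (hw l hl).trans (by gcongr)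

lemma balanced_growthBody : Balanced ℂ (growthBody r ξ ε) := by
  rintro a ha _ ⟨w, hw, rfl⟩ l hl
  rw [smul_smul]
  exact hw _ (by rw [norm_mul]; exact mul_le_one₀ hl (norm_nonneg a) ha)

variable [Module ℝ E]

lemma balanced_real_growthBody [IsScalarTower ℝ ℂ E] : Balanced ℝ (growthBody r ξ ε) :=
  balanced_iff_smul_mem.2 fun a ha w hw => by
    rw [← algebraMap_smul ℂ a w]
    exact balanced_growthBody.smul_mem (by simpa using ha) hw

lemma growthBody_subset_smul [IsScalarTower ℝ ℂ E] {a : ℝ} (ha : 1 ≤ a) :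
    growthBody r ξ ε ⊆ a • growthBody r ξ ε :=
  balanced_real_growthBody.subset_smul (ha.trans (le_abs_self a))

lemma convex_growthBody [IsScalarTower ℝ ℂ E] (hr : ConvexOn ℝ univ r) :
    Convex ℝ (growthBody r ξ ε) := by
  intro x hx y hy a b ha hb hab l hl
  have e : ξ + l • (a • x + b • y) = a • (ξ + l • x) + b • (ξ + l • y) := by
    rw [smul_add, smul_comm l a, smul_comm l b, smul_add, smul_add, add_add_add_comm, ← add_smul,
      hab, one_smul]
  calc r (ξ + l • (a • x + b • y)) ≤ a * r (ξ + l • x) + b * r (ξ + l • y) := by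
        rw [e]
        exact hr.2 (mem_univ _) (mem_univ _) ha hb hab
    _ ≤ a * (r ξ + ε) + b * (r ξ + ε) := by gcongr; exacts [hx l hl, hy l hl]
    _ = r ξ + ε := by rw [← add_mul, hab, one_mul]

lemma abs_sub_le_of_mem_growthBody (hr : ConvexOn ℝ univ r) (hw : w ∈ growthBody r ξ ε) {l : ℂ}
    (hl : ‖l‖ ≤ 1) : |r (ξ + l • w) - r ξ| ≤ ε := by
  have hpos := hw l hl
  have hneg := hw (-l) (by rwa [norm_neg])
  have hmid : r ξ ≤ (1 / 2) * r (ξ + l • w) + (1 / 2) * r (ξ + (-l) • w) := by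
    have e : ξ = (1 / 2 : ℝ) • (ξ + l • w) + (1 / 2 : ℝ) • (ξ + (-l) • w) := by
      rw [neg_smul]
      generalize l • w = x
      module
    conv_lhs => rw [e]
    exact hr.2 (mem_univ _) (mem_univ _) (by norm_num) (by norm_num) (by norm_num)
  rw [abs_le]
  constructor <;> linarith

lemma sub_le_mul_of_convexOn {F : Type*} [AddCommGroup F] [Module ℝ F] {r : F → ℝ}
    (hr : ConvexOn ℝ univ r) (ξ w : F) {s : ℝ} (hs : 0 ≤ s) (hs1 : s ≤ 1) :
    r (ξ + s • w) - r ξ ≤ s * (r (ξ + w) - r ξ) := by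
  have h := hr.2 (mem_univ ξ) (mem_univ (ξ + w)) (sub_nonneg.2 hs1) hs (sub_add_cancel 1 s)
  have e : (1 - s) • ξ + s • (ξ + w) = ξ + s • w := by module
  rw [e, smul_eq_mul, smul_eq_mul] at h
  linarith

lemma smul_mem_growthBody_mul [IsScalarTower ℝ ℂ E] (hr : ConvexOn ℝ univ r)
    (hw : w ∈ growthBody r ξ ε) {s : ℝ} (hs : 0 ≤ s) (hs1 : s ≤ 1) :
    s • w ∈ growthBody r ξ (s * ε) := fun l hl => by
  have h := sub_le_mul_of_convexOn hr ξ (l • w) hs hs1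
  rw [smul_comm l s]
  nlinarith [hw l hl]

end Module

lemma sum_mem_sum_smul {E ι : Type*} [AddCommGroup E] [Module ℝ E] {K : Set E}
    (hK : Convex ℝ K) (hne : K.Nonempty) (s : Finset ι) {c : ι → ℝ} {f : ι → E}
    (hc : ∀ i ∈ s, 0 ≤ c i) (hf : ∀ i ∈ s, f i ∈ c i • K) :
    ∑ i ∈ s, f i ∈ (∑ i ∈ s, c i) • K := by
  classical
  induction s using Finset.induction_on with
  | empty => simp [zero_smul_set hne]
  | insert i s hi ih =>
    rw [Finset.sum_insert hi, Finset.sum_insert hi,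
      hK.add_smul (hc i (by simp)) (Finset.sum_nonneg fun j hj => hc j (by simp [hj]))]
    exact add_mem_add (hf i (by simp))
      (ih (fun j hj => hc j (by simp [hj])) fun j hj => hf j (by simp [hj]))

end GrowthBody

/-! ### Complex lines -/

section Lines

lemma exists_lt_along_ray {E : Type*} [NormedAddCommGroup E] [NormedSpace ℝ E] {r : E → ℝ}
    (hr : ConvexOn ℝ univ r) (hne : {z | r z < 0}.Nonempty)
    (hbdd : Bornology.IsBounded {z | r z < 0}) (ξ : E) {v : E} (hv : v ≠ 0) (A : ℝ) :
    ∃ t : ℝ, A < r (ξ + t • v) := by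
  by_contra! hle
  obtain ⟨z, hz : r z < 0⟩ := hne
  obtain ⟨R, hR⟩ := hbdd.exists_norm_le
  -- Moving the whole line towards z by a suitable homothety puts it inside the sublevel set.
  set s : ℝ := -r z / (2 * (|A| - r z))
  have hA : 0 < |A| - r z := by linarith [abs_nonneg A]
  have hs : 0 < s := div_pos (neg_pos.2 hz) (by positivity)
  have hs1 : s ≤ 1 := (div_le_one (by positivity)).2 (by linarith [abs_nonneg A])
  have hline : ∀ t : ℝ, ‖(1 - s) • z + s • (ξ + t • v)‖ ≤ R := fun t => hR _ <| by
    calc r ((1 - s) • z + s • (ξ + t • v)) ≤ (1 - s) * r z + s * r (ξ + t • v) :=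
          hr.2 (mem_univ _) (mem_univ _) (sub_nonneg.2 hs1) hs.le (sub_add_cancel 1 s)
      _ ≤ (1 - s) * r z + s * |A| := by gcongr; exact (hle t).trans (le_abs_self A)
      _ = r z / 2 := by simp only [s]; field_simp; ring
      _ < 0 := by linarith
  set y := (1 - s) • z + s • ξ
  have hsv : 0 < s * ‖v‖ := mul_pos hs (norm_pos_iff.2 hv)
  set t : ℝ := (R + ‖y‖ + 1) / (s * ‖v‖)
  have hR0 : 0 ≤ R := (norm_nonneg _).trans (hline 0)
  have ht : ‖(s * t) • v‖ = R + ‖y‖ + 1 := by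
    rw [norm_smul, Real.norm_of_nonneg (by positivity)]
    simp only [t]
    field_simp
  have htri : ‖(s * t) • v‖ ≤ ‖(1 - s) • z + s • (ξ + t • v)‖ + ‖y‖ := by
    have e : (s * t) • v = (1 - s) • z + s • (ξ + t • v) - y := by simp only [y]; module
    rw [e]
    exact norm_sub_le _ _
  linarith [hline t]

variable {r : Cn n → ℝ} {ξ v : Cn n} {ε : ℝ} {l : ℂ}

lemma exists_level_on_line (hcont : Continuous r) (hε : 0 ≤ ε)
    (hlt : ∃ l : ℂ, r ξ + ε < r (ξ + l • v)) : ∃ l : ℂ, r (ξ + l • v) = r ξ + ε :=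
  mem_range_of_exists_le_of_exists_ge (f := fun l : ℂ => r (ξ + l • v)) (by fun_prop)
    ⟨0, by simpa using hε⟩ (hlt.imp fun _ => le_of_lt)

lemma smul_mem_growthBody_of_norm_le_lineDist (hcont : Continuous r) (hε : 0 < ε) (hv : ‖v‖ = 1)
    (hl : ‖l‖ ≤ lineDist r ξ v ε) : l • v ∈ growthBody r ξ ε := by
  intro m hm
  by_contra! hlt
  rw [smul_smul] at hlt
  have hc : ContinuousOn (fun s : ℝ => r (ξ + ((s : ℂ) * (m * l)) • v)) (Icc 0 1) := by
    fun_prop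
  obtain ⟨s, hs, hlevel⟩ := intermediate_value_Ioo zero_le_one hc
    (show r ξ + ε ∈ Ioo _ _ by simpa using ⟨hε, hlt⟩)
  have hdist : ‖l‖ ≤ s * (‖m‖ * ‖l‖) := by
    have := hl.trans (Metric.infDist_le_dist_of_mem ⟨hlevel, _, rfl⟩)
    rwa [dist_self_add_right, norm_smul, hv, mul_one, norm_mul, norm_mul, Complex.norm_real,
      Real.norm_of_nonneg hs.1.le] at this
  have hl0 : 0 < ‖l‖ := by
    rw [norm_pos_iff]
    rintro rfl
    simp at hlt
    linarith
  have : s * (‖m‖ * ‖l‖) < ‖l‖ := by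
    calc s * (‖m‖ * ‖l‖) ≤ s * (1 * ‖l‖) := by gcongr; exact hs.1.le
      _ < 1 * (1 * ‖l‖) := by gcongr; exact hs.2
      _ = ‖l‖ := by ring
  linarith

lemma norm_le_lineDist_of_smul_mem_growthBody (hr : ConvexOn ℝ univ r) (hε : 0 < ε) (hv : ‖v‖ = 1)
    (h : l • v ∈ growthBody r ξ ε) (hlevel : ∃ m : ℂ, r (ξ + m • v) = r ξ + ε) :
    ‖l‖ ≤ lineDist r ξ v ε := by
  obtain ⟨m₀, hm₀⟩ := hlevel
  have hne : {z | r z = r ξ + ε ∧ ∃ m : ℂ, z = ξ + m • v}.Nonempty := ⟨_, hm₀, m₀, rfl⟩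
  refine (Metric.le_infDist hne).2 ?_
  rintro _ ⟨hz, m, rfl⟩
  rw [dist_self_add_right, norm_smul, hv, mul_one]
  by_contra! hlt
  have hl0 : 0 < ‖l‖ := (norm_nonneg m).trans_lt hlt
  set s := ‖m‖ / ‖l‖
  have hs1 : s < 1 := (div_lt_one hl0).2 hlt
  have hmem : m • v ∈ growthBody r ξ (s * ε) := by
    have := smul_mem_growthBody_mul hr h (s := s) (by positivity) hs1.le
    rw [← Complex.coe_smul, smul_smul] at this
    refine (balanced_growthBody.smul_mem_iff ?_).1 this
    rw [norm_mul, Complex.norm_real, Real.norm_of_nonneg (by positivity), div_mul_cancel₀ _ hl0.ne']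
  have := hmem 1 (by simp)
  rw [one_smul, hz] at this
  nlinarith

lemma smul_mem_growthBody_of_norm_le_tau (hcont : Continuous r) (hε : 0 ≤ ε)
    (hl : ‖l‖ ≤ tau r ξ v ε) : l • v ∈ growthBody r ξ ε := by
  rcases eq_or_ne l 0 with rfl | hl0
  · simpa using zero_mem_growthBody hε
  replace hl0 := norm_pos_iff.2 hl0
  have hne : {c : ℝ | 0 < c ∧ ∀ l : ℂ, ‖l‖ ≤ c → |r (ξ + l • v) - r ξ| ≤ ε}.Nonempty := by
    by_contra! he
    rw [tau, he, Real.sSup_empty] at hl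
    linarith
  intro m hm
  have hIco : Ico (0 : ℝ) 1 ⊆ {s | r (ξ + ((s : ℂ) * (m * l)) • v) ≤ r ξ + ε} := by
    intro s hs
    obtain ⟨c, ⟨-, hc⟩, hlc⟩ := exists_lt_of_lt_csSup hne
      (lt_of_lt_of_le (mul_lt_of_lt_one_left hl0 hs.2) hl)
    have := hc ((s : ℂ) * (m * l)) <| by
      rw [norm_mul, norm_mul, Complex.norm_real, Real.norm_of_nonneg hs.1]
      calc s * (‖m‖ * ‖l‖) ≤ s * (1 * ‖l‖) := by gcongr; exact hs.1
        _ ≤ c := by rw [one_mul]; exact hlc.le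
    exact sub_le_iff_le_add'.1 (abs_sub_le_iff.1 this).1
  have hclosed : IsClosed {s : ℝ | r (ξ + ((s : ℂ) * (m * l)) • v) ≤ r ξ + ε} :=
    isClosed_le (by fun_prop) continuous_const
  have h1 : (1 : ℝ) ∈ closure (Ico 0 1) := by
    rw [closure_Ico zero_ne_one]
    exact right_mem_Icc.2 zero_le_one
  simpa [smul_smul] using hclosed.closure_subset_iff.2 hIco h1

lemma norm_le_tau_of_smul_mem_growthBody (hr : ConvexOn ℝ univ r)
    (h : l • v ∈ growthBody r ξ ε) (hunb : ∃ m : ℂ, r ξ + ε < r (ξ + m • v)) :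
    ‖l‖ ≤ tau r ξ v ε := by
  rcases eq_or_ne l 0 with rfl | hl
  · exact norm_zero.trans_le (Real.sSup_nonneg fun _ h => h.1.le)
  obtain ⟨m, hm⟩ := hunb
  refine le_csSup ⟨‖m‖, ?_⟩ ⟨norm_pos_iff.2 hl, fun k hk => ?_⟩
  · rintro c ⟨-, hc⟩
    by_contra! hlt
    linarith [(abs_le.1 (hc m hlt.le)).2]
  · have := abs_sub_le_of_mem_growthBody hr h (l := k / l) (by
      rw [norm_div]; exact div_le_one_of_le₀ hk (norm_nonneg _))
    rwa [smul_smul, div_mul_cancel₀ _ hl] at this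

end Lines

section SmoothConvex

variable {F : Type*} [NormedAddCommGroup F] [InnerProductSpace ℝ F] [CompleteSpace F] {r : F → ℝ}

lemma inner_gradient_le_sub (hr : ConvexOn ℝ univ r) {ξ : F} (hd : DifferentiableAt ℝ r ξ)
    (w : F) : inner ℝ (gradient r ξ) w ≤ r (ξ + w) - r ξ := by
  have hline : HasDerivAt (fun t : ℝ => ξ + t • w) w 0 := by
    simpa using ((hasDerivAt_id (0 : ℝ)).smul_const w).const_add ξ
  have hderiv : HasDerivAt (fun t : ℝ => r (ξ + t • w)) (inner ℝ (gradient r ξ) w) 0 := by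
    have h : HasFDerivAt r (innerSL ℝ (gradient r ξ)) (ξ + (0 : ℝ) • w) := by
      rw [zero_smul, add_zero]
      exact hd.hasGradientAt
    exact h.comp_hasDerivAt (0 : ℝ) hline
  have hconv : ConvexOn ℝ univ fun t : ℝ => r (ξ + t • w) := by
    simpa [Function.comp_def, AffineMap.lineMap_apply, add_comm] using
      hr.comp_affineMap (AffineMap.lineMap ξ (ξ + w))
  simpa [slope_def_field] using
    hconv.le_slope_of_hasDerivAt (mem_univ 0) (mem_univ 1) one_pos hderiv

lemma exists_pos_le_norm_gradient (hr : ConvexOn ℝ univ r) (hd : Differentiable ℝ r)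
    (hneg : ∃ z, r z < 0) {S : Set F} (hS : Bornology.IsBounded S) :
    ∃ g : ℝ, 0 < g ∧ ∀ ξ ∈ S, 0 ≤ r ξ → g ≤ ‖gradient r ξ‖ := by
  obtain ⟨z, hz⟩ := hneg
  obtain ⟨R, hR0, hR⟩ := hS.subset_closedBall_lt 0 z
  refine ⟨-r z / R, div_pos (neg_pos.2 hz) hR0, fun ξ hξ hrξ => ?_⟩
  rw [div_le_iff₀ hR0]
  have htangent := inner_gradient_le_sub hr (hd ξ) (z - ξ)
  rw [add_sub_cancel] at htangent
  calc -r z ≤ -inner ℝ (gradient r ξ) (z - ξ) := by linarith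
    _ ≤ ‖gradient r ξ‖ * ‖z - ξ‖ :=
      (neg_le_abs _).trans (abs_real_inner_le_norm _ _)
    _ ≤ ‖gradient r ξ‖ * R := by
      gcongr
      rw [← dist_eq_norm, dist_comm]
      exact hR hξ

end SmoothConvex

section Components

lemma exists_closedBall_subset_growthBody {E : Type*} [NormedAddCommGroup E] [NormedSpace ℂ E]
    [NormedSpace ℝ E] [ProperSpace E] {r : E → ℝ} (hr : ContDiff ℝ 1 r) {S : Set E}
    (hS : Bornology.IsBounded S) : ∃ L : ℝ, 1 ≤ L ∧ ∀ ξ ∈ S, ∀ ε : ℝ, ε ≤ 1 →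
      Metric.closedBall 0 (ε / L) ⊆ growthBody r ξ ε := by
  obtain ⟨R, hR⟩ := hS.exists_norm_le
  obtain ⟨K, hK⟩ := hr.contDiffOn.exists_lipschitzOnWith one_ne_zero
    (convex_closedBall (0 : E) (R + 1)) (isCompact_closedBall _ _)
  set L : ℝ := max 1 K
  have hL : 1 ≤ L := le_max_left _ _
  refine ⟨L, hL, fun ξ hξ ε hε1 w hw l hl => ?_⟩
  rw [mem_closedBall_zero_iff, le_div_iff₀ (by positivity)] at hw
  have hlw : ‖l • w‖ ≤ ‖w‖ := by
    rw [norm_smul]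
    exact mul_le_of_le_one_left (norm_nonneg w) hl
  have hlip := hK.dist_le_mul (ξ + l • w) (by
      rw [mem_closedBall_zero_iff]
      have : ‖w‖ ≤ ‖w‖ * L := le_mul_of_one_le_right (norm_nonneg w) hL
      linarith [norm_add_le ξ (l • w), hR ξ hξ]) ξ (by
      rw [mem_closedBall_zero_iff]
      linarith [hR ξ hξ])
  rw [dist_self_add_left, Real.dist_eq] at hlip
  have : r (ξ + l • w) - r ξ ≤ ε :=
    calc r (ξ + l • w) - r ξ ≤ K * ‖l • w‖ := (le_abs_self _).trans hlip
      _ ≤ L * ‖w‖ := by gcongr; exact le_max_right _ _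
      _ ≤ ε := by linarith
  linarith

lemma inner_smul_mem_smul {E : Type*} [NormedAddCommGroup E] [InnerProductSpace ℂ E]
    [NormedSpace ℝ E] [IsScalarTower ℝ ℂ E] {b : Fin n → E} (hb : Orthonormal ℂ b) {K : Set E}
    (hK : Convex ℝ K) (hbal : Balanced ℝ K) {A : ℝ} (hA : 0 ≤ A)
    (hstep : ∀ k, ∀ w ∈ K, (∀ j < k, inner ℂ (b j) w = 0) → inner ℂ (b k) w • b k ∈ A • K)
    (m : ℕ) : ∀ k i : Fin n, k.val + m = i → ∀ w ∈ K, (∀ j < k, inner ℂ (b j) w = 0) →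
      inner ℂ (b i) w • b i ∈ (A * (1 + A) ^ m) • K := by
  induction m with
  | zero =>
    intro k i hki w hw horth
    obtain rfl : k = i := Fin.ext hki
    simpa using hstep k w hw horth
  | succ m ih =>
    intro k i hki w hw horth
    -- Removing the component along the `k`-th vector costs a factor `1 + A`.
    have hrest : w - inner ℂ (b k) w • b k ∈ (1 + A) • K := by
      rw [hK.add_smul zero_le_one hA, one_smul, sub_eq_add_neg]
      exact add_mem_add hw ((hbal.smul A).neg_mem_iff.2 (hstep k w hw horth))
    obtain ⟨w', hw', hw'eq⟩ := mem_smul_set.1 hrest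
    have hinner : ∀ j, ((1 + A : ℝ) : ℂ) * inner ℂ (b j) w' =
        inner ℂ (b j) w - inner ℂ (b k) w * inner ℂ (b j) (b k) := fun j => by
      rw [← inner_smul_right, ← inner_smul_right, ← inner_sub_right, ← hw'eq]
      exact congrArg _ (RCLike.real_smul_eq_coe_smul _ _).symm
    have hA1 : ((1 + A : ℝ) : ℂ) ≠ 0 := by exact_mod_cast (by positivity : (1 + A : ℝ) ≠ 0)
    have horth' : ∀ j : Fin n, j.val < k + 1 → inner ℂ (b j) w' = 0 := fun j hj => by
      refine (mul_eq_zero.1 ?_).resolve_left hA1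
      rw [hinner]
      rcases (Nat.lt_succ_iff.1 hj).lt_or_eq with hlt | heq
      · simp [horth j hlt, hb.2 (Fin.ne_of_lt hlt)]
      · simp [Fin.ext heq, inner_self_eq_norm_sq_to_K, hb.1 k]
    have hik : i ≠ k := fun h => by simp [h] at hki
    have hi : inner ℂ (b i) w = ((1 + A : ℝ) : ℂ) * inner ℂ (b i) w' := by
      rw [hinner, hb.2 hik, mul_zero, sub_zero]
    have := ih ⟨k + 1, by omega⟩ i (by simp; omega) w' hw' fun j hj => horth' j hj
    have e : inner ℂ (b i) w • b i = (1 + A) • inner ℂ (b i) w' • b i := by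
      rw [hi, mul_smul]
      exact (RCLike.real_smul_eq_coe_smul _ _).symm
    rw [e, pow_succ', mul_left_comm, mul_smul (1 + A)]
    exact smul_mem_smul_set this

end Components

/-! ### Growth bodies and polydiscs -/

section Polydisc

/-- A smooth convex function r on ℂⁿ defining a nonempty bounded domain; contrary to
`IsConvexFiniteType`, there is no condition of finite type and no normalization of the gradient. -/
structure IsBoundedConvex (r : Cn n → ℝ) : Prop where
  smooth : ContDiff ℝ ∞ r
  convex : ConvexOn ℝ univ r
  nonempty : (dom r).Nonempty
  bounded : Bornology.IsBounded (dom r)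

variable {r : Cn n → ℝ} {ξ w z : Cn n} {ε : ℝ} {b : Fin n → Cn n} {k : Fin n}
  {u : Cn n → ℝ → Fin n → Cn n}

lemma IsBoundedConvex.continuous (hr : IsBoundedConvex r) : Continuous r := hr.smooth.continuous

lemma IsBoundedConvex.differentiable (hr : IsBoundedConvex r) : Differentiable ℝ r :=
  hr.smooth.differentiable (by simp)

lemma IsBoundedConvex.isCompact_bd (hr : IsBoundedConvex r) : IsCompact (bd r) :=
  hr.bounded.isCompact_closure.of_isClosed_subset isClosed_frontier frontier_subset_closure

lemma IsBoundedConvex.exists_lt_on_line (hr : IsBoundedConvex r) (ξ : Cn n) {v : Cn n}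
    (hv : v ≠ 0) (A : ℝ) : ∃ l : ℂ, A < r (ξ + l • v) := by
  obtain ⟨t, ht⟩ := exists_lt_along_ray hr.convex hr.nonempty hr.bounded ξ hv A
  exact ⟨t, by rwa [Complex.coe_smul]⟩

lemma eq_zero_of_mem_bd (hcont : Continuous r) (hξ : ξ ∈ bd r) : r ξ = 0 :=
  frontier_lt_subset_eq hcont continuous_const hξ

lemma inner_real_eq_re (x y : Cn n) : inner ℝ x y = (inner ℂ x y).re := by
  simp [PiLp.inner_apply, Complex.inner]

lemma norm_inner_gradient_le (hr : ConvexOn ℝ univ r) (hd : DifferentiableAt ℝ r ξ)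
    (hw : w ∈ growthBody r ξ ε) : ‖inner ℂ (gradient r ξ) w‖ ≤ ε := by
  obtain ⟨l, hl, hlI⟩ := Complex.exists_norm_eq_mul_self (inner ℂ (gradient r ξ) w)
  have htangent := inner_gradient_le_sub hr hd (l • w)
  rw [inner_real_eq_re, inner_smul_right, ← hlI, Complex.ofReal_re] at htangent
  linarith [hw l hl.le]

lemma IsExtremalBasis.norm_inner_first_le (hr : IsBoundedConvex r) (hε : 0 < ε)
    (hb : IsExtremalBasis r ξ ε b) (hk : k.val = 0) (hw : w ∈ growthBody r ξ ε) :
    ‖gradient r ξ‖ * ‖inner ℂ (b k) w‖ ≤ ε := by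
  obtain ⟨q, ⟨t, rfl⟩, hq, hbk⟩ := hb.first k hk
  have ht : t • gradient r ξ ≠ 0 := fun h => by
    rw [h, add_zero] at hq
    linarith
  obtain ⟨ht0, hg0⟩ := smul_ne_zero_iff.1 ht
  rw [add_sub_cancel_left, norm_smul, smul_smul, ← Complex.coe_smul] at hbk
  refine le_of_eq_of_le ?_ (norm_inner_gradient_le hr.convex (hr.differentiable ξ) hw)
  rw [hbk, inner_smul_left, norm_mul, RCLike.norm_conj, Complex.norm_real, norm_mul, norm_inv,
    norm_mul, norm_norm, norm_norm]
  have := norm_ne_zero_iff.2 ht0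
  have := norm_ne_zero_iff.2 hg0
  field_simp

lemma IsExtremalBasis.inner_smul_mem_of_orthogonal (hr : IsBoundedConvex r) (hε : 0 < ε)
    (hb : IsExtremalBasis r ξ ε b) (hk : 0 < k.val) (hw : w ∈ growthBody r ξ ε)
    (horth : ∀ j < k, inner ℂ (b j) w = 0) : inner ℂ (b k) w • b k ∈ growthBody r ξ ε := by
  rcases eq_or_ne w 0 with rfl | hw0
  · simpa using zero_mem_growthBody hε.le
  set v : Cn n := ((‖w‖ : ℂ)⁻¹) • w
  have hnorm : (‖w‖ : ℂ) ≠ 0 := by simpa using hw0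
  have hv : ‖v‖ = 1 := norm_smul_inv_norm hw0
  have hwv : (‖w‖ : ℂ) • v = w := smul_inv_smul₀ hnorm w
  have hmax : lineDist r ξ v ε ≤ lineDist r ξ (b k) ε :=
    hb.next k hk v hv fun j hj => by rw [inner_smul_right, horth j hj, mul_zero]
  have hdist : ‖w‖ ≤ lineDist r ξ v ε := by
    have := norm_le_lineDist_of_smul_mem_growthBody hr.convex hε hv (hwv.symm ▸ hw)
      (exists_level_on_line hr.continuous hε.le
        (hr.exists_lt_on_line ξ (norm_ne_zero_iff.1 (hv ▸ one_ne_zero)) _))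
    simpa using this
  refine smul_mem_growthBody_of_norm_le_lineDist hr.continuous hε (hb.orthonormal.1 k) ?_
  calc ‖inner ℂ (b k) w‖ ≤ ‖b k‖ * ‖w‖ := norm_inner_le_norm _ _
    _ = ‖w‖ := by rw [hb.orthonormal.1 k, one_mul]
    _ ≤ lineDist r ξ (b k) ε := hdist.trans hmax

lemma IsExtremalBasis.exists_inner_smul_mem (hr : IsBoundedConvex r) :
    ∃ A : ℝ, 1 ≤ A ∧ ∀ ξ ∈ bd r, ∀ ε : ℝ, 0 < ε → ε ≤ 1 → ∀ b, IsExtremalBasis r ξ ε b →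
      ∀ w ∈ growthBody r ξ ε, ∀ i, inner ℂ (b i) w • b i ∈ A • growthBody r ξ ε := by
  obtain ⟨L, hL, hball⟩ := exists_closedBall_subset_growthBody (hr.smooth.of_le (by simp))
    hr.isCompact_bd.isBounded
  obtain ⟨g, hg, hgrad⟩ := exists_pos_le_norm_gradient hr.convex hr.differentiable hr.nonempty
    hr.isCompact_bd.isBounded
  set A : ℝ := max 1 (L / g)
  have hA : 1 ≤ A := le_max_left _ _
  refine ⟨A * (1 + A) ^ n, by nlinarith [one_le_pow₀ (by linarith : 1 ≤ 1 + A) (n := n)],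
    fun ξ hξ ε hε hε1 b hb w hw i => ?_⟩
  have hbal : Balanced ℝ (growthBody r ξ ε) := balanced_real_growthBody
  have hstep : ∀ k, ∀ w ∈ growthBody r ξ ε, (∀ j < k, inner ℂ (b j) w = 0) →
      inner ℂ (b k) w • b k ∈ A • growthBody r ξ ε := by
    intro k w hw horth
    rcases k.val.eq_zero_or_pos with hk | hk
    · have hA0 : A ≠ 0 := by positivity
      rw [mem_smul_set_iff_inv_smul_mem₀ hA0]
      apply hball ξ hξ ε hε1
      rw [mem_closedBall_zero_iff, norm_smul, norm_smul, hb.orthonormal.1 k, mul_one, norm_inv,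
        Real.norm_of_nonneg (by positivity), inv_mul_le_iff₀ (by positivity)]
      have hgξ := hgrad ξ hξ (eq_zero_of_mem_bd hr.continuous hξ).ge
      have := hb.norm_inner_first_le hr hε hk hw
      calc ‖inner ℂ (b k) w‖ ≤ ε / g := by
            rw [le_div_iff₀' hg]
            exact (by gcongr : _ ≤ _).trans this
        _ = L / g * (ε / L) := by field_simp
        _ ≤ A * (ε / L) := by gcongr; exact le_max_right _ _
    · exact growthBody_subset_smul hA (hb.inner_smul_mem_of_orthogonal hr hε hk hw horth)
  have hn : 0 < n := i.pos
  have := inner_smul_mem_smul hb.orthonormal (convex_growthBody hr.convex) hbal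
    (zero_le_one.trans hA) hstep i ⟨0, hn⟩ i (by simp) w hw fun j hj => by
      simp [Fin.lt_def] at hj
  refine hbal.smul_mono ?_ this
  rw [Real.norm_of_nonneg (by positivity), Real.norm_of_nonneg (by positivity)]
  gcongr
  · linarith
  · exact i.is_lt.le

lemma mem_polydisc_of_inner_smul_mem (hr : IsBoundedConvex r) (hb : Orthonormal ℂ (u ξ ε))
    (h : ∀ i, inner ℂ (u ξ ε i) (z - ξ) • u ξ ε i ∈ growthBody r ξ ε) : z ∈ polydisc r u ξ ε := by
  refine ⟨fun i => inner ℂ (u ξ ε i) (z - ξ), fun i =>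
    norm_le_tau_of_smul_mem_growthBody hr.convex (h i) (hr.exists_lt_on_line ξ (hb.ne_zero i) _),
    ?_⟩
  have hspan : ⊤ ≤ Submodule.span ℂ (range (u ξ ε)) := by
    rw [hb.linearIndependent.span_eq_top_of_card_eq_finrank' (by simp)]
  have := (OrthonormalBasis.mk hb hspan).sum_repr' (z - ξ)
  rw [OrthonormalBasis.coe_mk] at this
  rw [this, add_sub_cancel]

lemma exists_mem_polydisc_of_smul_mem_growthBody (hr : IsBoundedConvex r) :
    ∃ A : ℝ, 1 ≤ A ∧ ∀ ξ ∈ bd r, ∀ ε : ℝ, 0 < ε → ε ≤ 1 → ∀ u : Cn n → ℝ → Fin n → Cn n,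
      IsExtremalBasis r ξ ε (u ξ ε) → ∀ z, A • (z - ξ) ∈ growthBody r ξ ε →
        z ∈ polydisc r u ξ ε := by
  obtain ⟨A, hA, hcomp⟩ := IsExtremalBasis.exists_inner_smul_mem hr
  refine ⟨A, hA, fun ξ hξ ε hε hε1 u hb z hz =>
    mem_polydisc_of_inner_smul_mem hr hb.orthonormal fun i => ?_⟩
  have := hcomp ξ hξ ε hε hε1 _ hb _ hz i
  rwa [← Complex.coe_smul, inner_smul_right, mul_smul, Complex.coe_smul,
    smul_mem_smul_set_iff₀ (by positivity)] at this

lemma sub_mem_smul_growthBody_of_mem_polydisc (hr : ConvexOn ℝ univ r) (hcont : Continuous r)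
    (hε : 0 ≤ ε) (hz : z ∈ polydisc r u ξ ε) : z - ξ ∈ (n : ℝ) • growthBody r ξ ε := by
  obtain ⟨l, hl, rfl⟩ := hz
  have hmem : ∀ k ∈ Finset.univ, l k • u ξ ε k ∈ (1 : ℝ) • growthBody r ξ ε := fun k _ => by
    rw [one_smul]
    exact smul_mem_growthBody_of_norm_le_tau hcont hε (hl k)
  have hsum := sum_mem_sum_smul (convex_growthBody hr) ⟨0, zero_mem_growthBody hε⟩ Finset.univ
    (fun _ _ => zero_le_one) hmem
  rw [Finset.sum_const, Finset.card_univ, Fintype.card_fin, nsmul_eq_mul, mul_one] at hsum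
  rwa [add_sub_cancel_left]

end Polydisc

/-! ### Taylor polynomials and the doubling of growth bodies -/

section Taylor

variable {F : Type*} [NormedAddCommGroup F] [NormedSpace ℝ F]

/-- The homogeneous part of degree `j` of the Taylor expansion of `f` at `ξ`, evaluated at the
increment `w`. -/
def taylorTerm (f : F → ℝ) (j : ℕ) (ξ w : F) : ℝ :=
  (j.factorial : ℝ)⁻¹ * iteratedFDeriv ℝ j f ξ fun _ => w

lemma taylorTerm_smul (f : F → ℝ) (j : ℕ) (ξ w : F) (t : ℝ) :
    taylorTerm f j ξ (t • w) = t ^ j * taylorTerm f j ξ w := by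
  have h := (iteratedFDeriv ℝ j f ξ).map_smul_univ (fun _ => t) fun _ => w
  rw [Finset.prod_const, Finset.card_univ, Fintype.card_fin, smul_eq_mul] at h
  rw [taylorTerm, h, taylorTerm, mul_left_comm]

lemma continuous_taylorTerm {f : F → ℝ} (hf : ContDiff ℝ ∞ f) (j : ℕ) :
    Continuous fun p : F × F => taylorTerm f j p.1 p.2 := by
  have h : Continuous (iteratedFDeriv ℝ j f) :=
    hf.continuous_iteratedFDeriv (by exact_mod_cast le_top)
  exact continuous_const.mul ((h.comp continuous_fst).eval (continuous_pi fun _ => continuous_snd))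

lemma exists_abs_sub_sum_taylorTerm_le [ProperSpace F] {f : F → ℝ} (hf : ContDiff ℝ ∞ f)
    {S : Set F} (hS : Bornology.IsBounded S) (m : ℕ) :
    ∃ A : ℝ, 0 ≤ A ∧ ∀ ξ ∈ S, ∀ w : F, ‖w‖ ≤ 1 →
      |f (ξ + w) - ∑ j ∈ Finset.range (m + 1), taylorTerm f j ξ w| ≤ A * ‖w‖ ^ (m + 1) := by
  obtain ⟨R, hR⟩ := hS.exists_norm_le
  obtain ⟨A, hA⟩ := (isCompact_closedBall (0 : F) (R + 1)).exists_bound_of_continuousOn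
    (hf.continuous_iteratedFDeriv (m := m + 1) (by exact_mod_cast le_top)).continuousOn
  refine ⟨max A 0, le_max_right _ _, fun ξ hξ w hw => ?_⟩
  have hTaylor := map_add_eq_sum_add_integral_iteratedFDeriv (n := m) (x := ξ) (y := w)
    fun t _ => hf.contDiffAt.of_le (by exact_mod_cast le_top)
  have hremainder : ∀ t ∈ uIoc (0 : ℝ) 1,
      ‖(1 - t) ^ m • iteratedFDeriv ℝ (m + 1) f (ξ + t • w) fun _ => w‖
        ≤ max A 0 * ‖w‖ ^ (m + 1) := by
    intro t ht
    rw [uIoc_of_le zero_le_one] at ht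
    have hball : ξ + t • w ∈ Metric.closedBall (0 : F) (R + 1) := by
      rw [mem_closedBall_zero_iff]
      refine (norm_add_le _ _).trans (add_le_add (hR ξ hξ) ?_)
      rw [norm_smul, Real.norm_of_nonneg ht.1.le]
      exact mul_le_one₀ ht.2 (norm_nonneg w) hw
    have hderiv := ContinuousMultilinearMap.le_of_opNorm_le
      ((hA _ hball).trans (le_max_left A 0)) fun _ => w
    rw [Finset.prod_const, Finset.card_univ, Fintype.card_fin] at hderiv
    rw [norm_smul, norm_pow, Real.norm_of_nonneg (sub_nonneg.2 ht.2)]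
    exact (mul_le_of_le_one_left (norm_nonneg _)
      (pow_le_one₀ (sub_nonneg.2 ht.2) (by linarith [ht.1]))).trans hderiv
  have hint := intervalIntegral.norm_integral_le_of_norm_le_const hremainder
  rw [sub_zero, abs_one, mul_one] at hint
  simp only [taylorTerm]
  rw [hTaylor]
  simp only [smul_eq_mul, add_sub_cancel_left, abs_mul] at hint ⊢
  refine (mul_le_of_le_one_left (abs_nonneg _) ?_).trans hint
  rw [abs_of_nonneg (by positivity)]
  exact inv_le_one_of_one_le₀ (by exact_mod_cast m.factorial_pos)

end Taylor

lemma exists_abs_coeff_le (m : ℕ) : ∃ B : ℝ, 0 ≤ B ∧ ∀ (b : ℕ → ℝ) (G : ℝ),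
    (∀ t ∈ Icc (0 : ℝ) 1, |∑ j ∈ Finset.range m, t ^ j * b j| ≤ G) → ∀ j < m, |b j| ≤ B * G := by
  let x : Fin m → ℝ := fun i => i / m
  have hx : ∀ i, x i ∈ Icc (0 : ℝ) 1 := fun i =>
    ⟨by positivity, div_le_one_of_le₀ (by exact_mod_cast i.2.le) (by positivity)⟩
  have hinj : Function.Injective x := fun i j hij => by
    have hm : (m : ℝ) ≠ 0 := by exact_mod_cast i.pos.ne'
    exact Fin.ext (by exact_mod_cast (div_left_inj' hm).1 hij)
  have hker : LinearMap.ker (Matrix.vandermonde x).mulVecLin = ⊥ := by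
    rw [LinearMap.ker_eq_bot, Matrix.coe_mulVecLin, Matrix.mulVec_injective_iff_isUnit,
      Matrix.isUnit_iff_isUnit_det, isUnit_iff_ne_zero, Matrix.det_vandermonde_ne_zero_iff]
    exact hinj
  obtain ⟨B, -, hB⟩ := LinearMap.exists_antilipschitzWith _ hker
  refine ⟨B, B.2, fun b G hG j hj => ?_⟩
  have hG0 : 0 ≤ G := (abs_nonneg _).trans (hG 0 ⟨le_rfl, zero_le_one⟩)
  have hvalues : ‖(Matrix.vandermonde x).mulVecLin fun i => b i‖ ≤ G := by
    refine (pi_norm_le_iff_of_nonneg hG0).2 fun i => ?_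
    simpa only [Matrix.mulVecLin_apply, Matrix.mulVec, dotProduct, Matrix.vandermonde_apply,
      Finset.sum_range, Real.norm_eq_abs] using hG (x i) (hx i)
  calc |b j| ≤ ‖fun i : Fin m => b i‖ := norm_le_pi_norm (fun i : Fin m => b i) ⟨j, hj⟩
    _ ≤ B * ‖(Matrix.vandermonde x).mulVecLin fun i => b i‖ := hB.le_mul_norm (map_zero _) _
    _ ≤ B * G := by gcongr

lemma exists_pos_forall_exists_lt {X ι : Type*} [TopologicalSpace X] {K : Set X}
    (hK : IsCompact K) {f : ι → X → ℝ} (hf : ∀ i, Continuous (f i))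
    (hpos : ∀ x ∈ K, ∃ i, 0 < f i x) : ∃ σ > 0, ∀ x ∈ K, ∃ i, σ < f i x := by
  obtain ⟨σ, hσ⟩ := hK.elim_directed_cover
    (fun σ : Ioi (0 : ℝ) => ⋃ i, {x | (σ : ℝ) < f i x})
    (fun σ => isOpen_iUnion fun i => isOpen_lt continuous_const (hf i))
    (fun x hx => by
      obtain ⟨i, hi⟩ := hpos x hx
      exact mem_iUnion.2 ⟨⟨f i x / 2, half_pos hi⟩, mem_iUnion.2 ⟨i, half_lt_self hi⟩⟩)
    (fun σ σ' => ⟨min σ σ',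
      iUnion_mono fun i x (hx : (σ : ℝ) < f i x) =>
        show ((min σ σ' : Ioi (0 : ℝ)) : ℝ) < f i x from lt_of_le_of_lt (min_le_left σ σ') hx,
      iUnion_mono fun i x (hx : (σ' : ℝ) < f i x) =>
        show ((min σ σ' : Ioi (0 : ℝ)) : ℝ) < f i x from lt_of_le_of_lt (min_le_right σ σ') hx⟩)
  exact ⟨σ, σ.2, fun x hx => mem_iUnion.1 (hσ hx)⟩

section FiniteType

variable {r : Cn n → ℝ} {ξ : Cn n} {M : ℕ}

lemma le_pointType_of_isBigO {v : Cn n} (hv : v ≠ 0) {s : ℕ}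
    (hs : (fun l : ℂ => r (ξ + l • v)) =O[𝓝 0] fun l => ‖l‖ ^ s) :
    (s : ℕ∞) ≤ pointType r ξ := by
  let P : Cn 1 →L[ℂ] Cn n := (EuclideanSpace.proj (0 : Fin 1) : Cn 1 →L[ℂ] ℂ).smulRight v
  have hnorm : ∀ w : Cn 1, ‖w‖ = ‖w 0‖ := fun w => by simp [EuclideanSpace.norm_eq]
  have hgerm : IsNonsingularGerm ξ fun w => ξ + P w := by
    refine ⟨one_pos, analyticAt_const.add (P.analyticAt 0), by simp, ?_⟩
    rw [fderiv_const_add, P.fderiv, injective_iff_map_eq_zero]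
    intro w hw
    have hw0 : w 0 = 0 := by simpa [P, hv] using hw
    rw [← norm_eq_zero, hnorm, hw0, norm_zero]
  have hcontact : (fun w => r (ξ + P w)) =O[𝓝 0] fun w : Cn 1 => ‖w‖ ^ s := by
    simp only [hnorm]
    have hproj : Tendsto (fun w : Cn 1 => w 0) (𝓝 0) (𝓝 0) :=
      (EuclideanSpace.proj (0 : Fin 1) : Cn 1 →L[ℂ] ℂ).continuous.tendsto' 0 0 (map_zero _)
    exact hs.comp_tendsto hproj
  exact (le_iSup₂ (f := fun (s : ℕ) (_ : (fun w => r (ξ + P w)) =O[𝓝 0]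
    fun w : Cn 1 => ‖w‖ ^ s) => (s : ℕ∞)) s hcontact).trans
    (le_iSup_of_le 1 (le_iSup₂ (f := fun (G : Cn 1 → Cn n) (_ : IsNonsingularGerm ξ G) =>
      contactOrder r G) (fun w => ξ + P w) hgerm))

lemma exists_taylorTerm_ne_zero (hr : ContDiff ℝ ∞ r) (hM : pointType r ξ ≤ M) {v : Cn n}
    (hv : v ≠ 0) : ∃ θ : ℂ, ‖θ‖ ≤ 1 ∧ ∃ j ≤ M, taylorTerm r j ξ (θ • v) ≠ 0 := by
  by_contra! hzero
  obtain ⟨A, -, hA⟩ :=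
    exists_abs_sub_sum_taylorTerm_le hr (Bornology.isBounded_singleton (x := ξ)) M
  have hflat : (fun l : ℂ => r (ξ + l • v)) =O[𝓝 0] fun l => ‖l‖ ^ (M + 1) := by
    have hsmall : ∀ᶠ l : ℂ in 𝓝 0, ‖l • v‖ ≤ 1 :=
      (((continuous_id.smul continuous_const).norm.tendsto' (0 : ℂ) 0 (by simp)).eventually
        (ge_mem_nhds one_pos))
    refine IsBigO.of_bound (A * ‖v‖ ^ (M + 1)) ?_
    filter_upwards [hsmall, Metric.closedBall_mem_nhds (0 : ℂ) one_pos] with l hlv hl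
    have hsum : ∑ j ∈ Finset.range (M + 1), taylorTerm r j ξ (l • v) = 0 :=
      Finset.sum_eq_zero fun j hj =>
        hzero l (mem_closedBall_zero_iff.1 hl) j (Finset.mem_range_succ_iff.1 hj)
    have hl' := hA ξ rfl (l • v) hlv
    rw [hsum, sub_zero, norm_smul, mul_pow] at hl'
    rw [Real.norm_eq_abs, norm_pow, norm_norm]
    linarith
  have hlt : ((M + 1 : ℕ) : ℕ∞) ≤ M := (le_pointType_of_isBigO hv hflat).trans hM
  exact absurd (by exact_mod_cast hlt) M.not_succ_le_self

lemma IsBoundedConvex.exists_lt_abs_taylorTerm (hr : IsBoundedConvex r) (hM : domainType r ≤ M) :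
    ∃ σ > 0, ∀ ξ ∈ bd r, ∀ v : Cn n, ‖v‖ = 1 →
      ∃ θ : ℂ, ‖θ‖ ≤ 1 ∧ ∃ j ≤ M, σ < |taylorTerm r j ξ (θ • v)| := by
  have hK : IsCompact (bd r ×ˢ Metric.sphere (0 : Cn n) 1) :=
    hr.isCompact_bd.prod (isCompact_sphere _ _)
  obtain ⟨σ, hσ, h⟩ := exists_pos_forall_exists_lt hK
    (f := fun (i : Metric.closedBall (0 : ℂ) 1 × Iic M) (p : Cn n × Cn n) =>
      |taylorTerm r i.2 p.1 ((i.1 : ℂ) • p.2)|)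
    (fun i => ((continuous_taylorTerm hr.smooth i.2).comp
      (continuous_fst.prodMk (continuous_snd.const_smul (i.1 : ℂ)))).abs)
    (by
      rintro ⟨ξ, v⟩ ⟨hξ, hv⟩
      have htype : pointType r ξ ≤ M := (le_iSup₂ (f := fun p (_ : p ∈ bd r) => pointType r p)
        ξ hξ).trans hM
      obtain ⟨θ, hθ, j, hj, hne⟩ := exists_taylorTerm_ne_zero hr.smooth htype
        (Metric.ne_of_mem_sphere hv one_ne_zero)
      exact ⟨(⟨θ, mem_closedBall_zero_iff.2 hθ⟩, ⟨j, hj⟩), abs_pos.2 hne⟩)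
  refine ⟨σ, hσ, fun ξ hξ v hv => ?_⟩
  obtain ⟨⟨θ, j⟩, hlt⟩ := h (ξ, v) ⟨hξ, mem_sphere_zero_iff_norm.2 hv⟩
  exact ⟨θ, mem_closedBall_zero_iff.1 θ.2, j, j.2, hlt⟩

lemma IsBoundedConvex.exists_abs_taylorTerm_le (hr : IsBoundedConvex r) (M : ℕ) :
    ∃ B > 0, ∀ ξ ∈ bd r, ∀ (w : Cn n) (E : ℝ), ‖w‖ ≤ 1 → w ∈ growthBody r ξ E →
      ∀ θ : ℂ, ‖θ‖ ≤ 1 → ∀ j ≤ M, |taylorTerm r j ξ (θ • w)| ≤ B * (E + ‖w‖ ^ (M + 1)) := by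
  obtain ⟨A, hA0, hA⟩ := exists_abs_sub_sum_taylorTerm_le hr.smooth hr.isCompact_bd.isBounded M
  obtain ⟨B, hB0, hB⟩ := exists_abs_coeff_le (M + 1)
  refine ⟨(B + 1) * (1 + A), by positivity, fun ξ hξ w E hw hwE θ hθ j hj => ?_⟩
  have h0 := eq_zero_of_mem_bd hr.continuous hξ
  have hE : 0 ≤ E := (abs_nonneg _).trans
    (abs_sub_le_of_mem_growthBody hr.convex hwE (l := 0) (by simp))
  refine (hB (fun j => taylorTerm r j ξ (θ • w)) (E + A * ‖w‖ ^ (M + 1)) (fun t ht => ?_) j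
    (Nat.lt_succ_of_le hj)).trans ?_
  · have htθ : ‖(t : ℂ) * θ‖ ≤ 1 := by
      rw [norm_mul, Complex.norm_real, Real.norm_of_nonneg ht.1]
      exact mul_le_one₀ ht.2 (norm_nonneg θ) hθ
    have hnorm : ‖t • θ • w‖ ≤ ‖w‖ := by
      rw [← Complex.coe_smul, smul_smul, norm_smul]
      exact mul_le_of_le_one_left (norm_nonneg w) htθ
    have hgrowth := abs_sub_le_of_mem_growthBody hr.convex hwE htθ
    rw [mul_smul, Complex.coe_smul, h0, sub_zero] at hgrowth
    have hTaylor := hA ξ hξ (t • θ • w) (hnorm.trans hw)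
    simp only [taylorTerm_smul r _ ξ (θ • w) t] at hTaylor
    have hpow : A * ‖t • θ • w‖ ^ (M + 1) ≤ A * ‖w‖ ^ (M + 1) := by gcongr
    rw [abs_le] at *
    constructor <;> linarith
  · have hpow : 0 ≤ ‖w‖ ^ (M + 1) := by positivity
    calc B * (E + A * ‖w‖ ^ (M + 1)) ≤ (B + 1) * (E + A * ‖w‖ ^ (M + 1)) := by
          gcongr
          linarith
      _ ≤ (B + 1) * ((1 + A) * (E + ‖w‖ ^ (M + 1))) := by
          gcongr
          nlinarith
      _ = (B + 1) * (1 + A) * (E + ‖w‖ ^ (M + 1)) := by ring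

lemma IsBoundedConvex.exists_mul_norm_pow_le (hr : IsBoundedConvex r) (hM : domainType r ≤ M) :
    ∃ κ > 0, ∀ ξ ∈ bd r, ∀ w : Cn n, w ≠ 0 → ‖w‖ ≤ κ → ∀ E, w ∈ growthBody r ξ E →
      κ * ‖w‖ ^ M ≤ E := by
  obtain ⟨σ, hσ, hlower⟩ := hr.exists_lt_abs_taylorTerm hM
  obtain ⟨B, hB, hupper⟩ := hr.exists_abs_taylorTerm_le M
  refine ⟨min 1 (σ / (2 * B)), by positivity, fun ξ hξ w hw0 hw E hwE => ?_⟩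
  have hw1 : ‖w‖ ≤ 1 := hw.trans (min_le_left _ _)
  have hwσ : 2 * B * ‖w‖ ≤ σ := (le_div_iff₀' (by positivity)).1 (hw.trans (min_le_right _ _))
  have hnorm : ‖w‖ ≠ 0 := norm_ne_zero_iff.2 hw0
  obtain ⟨θ, hθ, j, hj, hlt⟩ := hlower ξ hξ (‖w‖⁻¹ • w)
    (by rw [norm_smul, norm_inv, norm_norm, inv_mul_cancel₀ hnorm])
  have hhomog : taylorTerm r j ξ (θ • w) = ‖w‖ ^ j * taylorTerm r j ξ (θ • ‖w‖⁻¹ • w) := by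
    rw [← taylorTerm_smul, smul_comm θ, smul_inv_smul₀ hnorm]
  have hmain : σ * ‖w‖ ^ M ≤ B * (E + ‖w‖ ^ (M + 1)) :=
    calc σ * ‖w‖ ^ M ≤ |taylorTerm r j ξ (θ • ‖w‖⁻¹ • w)| * ‖w‖ ^ j := by
          gcongr ?_ * ?_
          exact pow_le_pow_of_le_one (norm_nonneg w) hw1 hj
      _ = |taylorTerm r j ξ (θ • w)| := by
          rw [hhomog, abs_mul, abs_of_nonneg (pow_nonneg (norm_nonneg w) j), mul_comm]
      _ ≤ B * (E + ‖w‖ ^ (M + 1)) := hupper ξ hξ w E hw1 hwE θ hθ j hj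
  have habsorb : 2 * B * ‖w‖ ^ (M + 1) ≤ σ * ‖w‖ ^ M := by
    rw [pow_succ', ← mul_assoc]
    gcongr
  calc min 1 (σ / (2 * B)) * ‖w‖ ^ M ≤ σ / (2 * B) * ‖w‖ ^ M := by
        gcongr
        exact min_le_right _ _
    _ ≤ E := by
        rw [div_mul_eq_mul_div, div_le_iff₀ (by positivity)]
        linarith

lemma IsBoundedConvex.exists_norm_le_of_mem_growthBody (hr : IsBoundedConvex r)
    (hM : domainType r ≤ M) {c : ℝ} (hc : 0 < c) :
    ∃ ε₀ > 0, ∀ ξ ∈ bd r, ∀ ε ≤ ε₀, ∀ w ∈ growthBody r ξ ε, ‖w‖ ≤ c := by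
  obtain ⟨κ, hκ, hpow⟩ := hr.exists_mul_norm_pow_le hM
  have hm : 0 < min c κ := lt_min hc hκ
  refine ⟨κ * min c κ ^ M / 2, by positivity, fun ξ hξ ε hε w hw => ?_⟩
  by_contra! hcw
  have hw0 : 0 < ‖w‖ := hc.trans hcw
  have hs : min c κ / ‖w‖ ≤ 1 := (div_le_one hw0).2 ((min_le_left _ _).trans hcw.le)
  have hnorm : ‖(min c κ / ‖w‖) • w‖ = min c κ := by
    rw [norm_smul, Real.norm_of_nonneg (by positivity), div_mul_cancel₀ _ hw0.ne']
  have hmem : (min c κ / ‖w‖) • w ∈ growthBody r ξ ε :=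
    balanced_real_growthBody.smul_mem
      (by rwa [Real.norm_of_nonneg (by positivity)]) hw
  have hlow := hpow ξ hξ _ (norm_pos_iff.1 (hnorm.symm ▸ hm)) (hnorm.trans_le (min_le_right _ _))
    ε hmem
  rw [hnorm] at hlow
  have hpos : 0 < κ * min c κ ^ M := by positivity
  linarith

lemma IsBoundedConvex.exists_two_smul_mem_growthBody (hr : IsBoundedConvex r)
    (hM : domainType r ≤ M) :
    ∃ D ≥ 1, ∃ ε₀ > 0, ∀ ξ ∈ bd r, ∀ ε, 0 ≤ ε → ε ≤ ε₀ → ∀ w ∈ growthBody r ξ ε,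
      (2 : ℝ) • w ∈ growthBody r ξ (D * ε) := by
  obtain ⟨κ, hκ, hpow⟩ := hr.exists_mul_norm_pow_le hM
  obtain ⟨B, hB, hupper⟩ := hr.exists_abs_taylorTerm_le M
  obtain ⟨A, hA0, hA⟩ := exists_abs_sub_sum_taylorTerm_le hr.smooth hr.isCompact_bd.isBounded M
  obtain ⟨ε₀, hε₀, hsmall⟩ :=
    hr.exists_norm_le_of_mem_growthBody hM (c := min κ (1 / 2)) (by positivity)
  let D : ℝ := 1 + (M + 1) * (2 ^ M * (B * (1 + 1 / κ))) + A * 2 ^ (M + 1) / κ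
  refine ⟨D, by simp only [D, add_assoc, ge_iff_le, le_add_iff_nonneg_right]; positivity, ε₀, hε₀,
    fun ξ hξ ε hε hεε₀ w hw => ?_⟩
  rcases eq_or_ne w 0 with rfl | hw0
  · rw [smul_zero]
    exact zero_mem_growthBody (by positivity)
  have hwκ := hsmall ξ hξ ε hεε₀ w hw
  have hw2 : ‖w‖ ≤ 1 / 2 := hwκ.trans (min_le_right _ _)
  have hremainder : ‖w‖ ^ (M + 1) ≤ ε / κ := by
    rw [le_div_iff₀' hκ]
    refine le_trans ?_ (hpow ξ hξ w hw0 (hwκ.trans (min_le_left _ _)) ε hw)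
    gcongr κ * ?_
    exact pow_le_pow_of_le_one (norm_nonneg w) (by linarith) M.le_succ
  intro l hl
  have hnorm : ‖l • w‖ ≤ ‖w‖ := by
    rw [norm_smul]
    exact mul_le_of_le_one_left (norm_nonneg w) hl
  have hTaylor := hA ξ hξ ((2 : ℝ) • l • w)
    (by rw [norm_smul, Real.norm_ofNat]; linarith)
  have hterm : ∀ j ∈ Finset.range (M + 1),
      taylorTerm r j ξ ((2 : ℝ) • l • w) ≤ 2 ^ M * (B * (ε + ε / κ)) := by
    intro j hj
    have hj' := Finset.mem_range_succ_iff.1 hj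
    rw [taylorTerm_smul]
    calc (2 : ℝ) ^ j * taylorTerm r j ξ (l • w)
        ≤ 2 ^ j * (B * (ε + ‖w‖ ^ (M + 1))) := by
          gcongr
          exact (le_abs_self _).trans (hupper ξ hξ w ε (by linarith) hw l hl j hj')
      _ ≤ 2 ^ M * (B * (ε + ε / κ)) := by
          gcongr
          exact one_le_two
  have hsum := Finset.sum_le_card_nsmul _ _ _ hterm
  rw [Finset.card_range, nsmul_eq_mul, Nat.cast_add_one] at hsum
  have hpow2 : A * ‖(2 : ℝ) • l • w‖ ^ (M + 1) ≤ A * (2 ^ (M + 1) * (ε / κ)) := by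
    rw [norm_smul, Real.norm_ofNat, mul_pow]
    gcongr
    exact (pow_le_pow_left₀ (norm_nonneg _) hnorm _).trans hremainder
  rw [smul_comm l, eq_zero_of_mem_bd hr.continuous hξ, zero_add]
  calc r (ξ + (2 : ℝ) • l • w)
      ≤ (M + 1) * (2 ^ M * (B * (ε + ε / κ))) + A * (2 ^ (M + 1) * (ε / κ)) := by
        linarith [(abs_le.1 hTaylor).2]
    _ = (D - 1) * ε := by simp only [D]; ring
    _ ≤ D * ε := by linarith

lemma IsBoundedConvex.exists_smul_mem_growthBody (hr : IsBoundedConvex r)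
    (hM : domainType r ≤ M) (a : ℝ) :
    ∃ D ≥ 1, ∃ ε₀ > 0, ∀ ξ ∈ bd r, ∀ ε, 0 ≤ ε → ε ≤ ε₀ → ∀ w ∈ growthBody r ξ ε,
      a • w ∈ growthBody r ξ (D * ε) := by
  obtain ⟨D, hD, ε₀, hε₀, hdouble⟩ := hr.exists_two_smul_mem_growthBody hM
  obtain ⟨m, hm⟩ := pow_unbounded_of_one_lt |a| one_lt_two
  have hiterate : ∀ k : ℕ, ∀ ξ ∈ bd r, ∀ ε, 0 ≤ ε → ε ≤ ε₀ / D ^ k → ∀ w ∈ growthBody r ξ ε,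
      (2 ^ k : ℝ) • w ∈ growthBody r ξ (D ^ k * ε) := by
    intro k
    induction k with
    | zero => simp
    | succ k ih =>
      intro ξ hξ ε hε hεk w hw
      rw [le_div_iff₀' (by positivity)] at hεk
      have hk : D ^ k * ε ≤ D ^ (k + 1) * ε := by
        gcongr
        exact k.le_succ
      have h := hdouble ξ hξ _ (by positivity) (hk.trans hεk) _
        (ih ξ hξ ε hε ((le_div_iff₀' (by positivity)).2 (hk.trans hεk)) w hw)
      rwa [smul_smul, ← mul_assoc, ← pow_succ', ← pow_succ'] at h
  refine ⟨D ^ m, one_le_pow₀ hD, ε₀ / D ^ m, by positivity, fun ξ hξ ε hε hεm w hw => ?_⟩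
  have h := balanced_real_growthBody.smul_mem (a := a / 2 ^ m)
    (by rw [norm_div, Real.norm_eq_abs, norm_pow, Real.norm_ofNat]
        exact div_le_one_of_le₀ hm.le (by positivity)) (hiterate m ξ hξ ε hε hεm w hw)
  rwa [smul_smul, div_mul_cancel₀ _ (by positivity)] at h

end FiniteType

lemma IsBoundedConvex.exists_engulfing {r : Cn n → ℝ} {M : ℕ} (hr : IsBoundedConvex r)
    (hM : domainType r ≤ M) (B : ℝ) :
    ∃ C₁ > 1, ∃ ε₁ > 0, ∀ u, IsExtremalChoice r u → ∀ ζ ∈ bd r, ∀ ε' > 0, ∀ ε ≥ ε', ε ≤ ε₁ →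
      ∀ p ∈ polydisc r u ζ ε', ∀ q, dist p q ≤ B * ε → q ∈ polydisc r u ζ (C₁ * ε) := by
  obtain ⟨A, -, hA⟩ := exists_mem_polydisc_of_smul_mem_growthBody hr
  obtain ⟨L, hL, hball⟩ := exists_closedBall_subset_growthBody
    (hr.smooth.of_le (by exact_mod_cast le_top)) hr.isCompact_bd.isBounded
  obtain ⟨D, hD, ε₀, hε₀, hscale⟩ := hr.exists_smul_mem_growthBody hM (A * (n + 1))
  let T : ℝ := 2 + L * |B|
  have hT : 2 ≤ T := le_add_of_nonneg_right (by positivity)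
  refine ⟨D * T, by nlinarith, min ε₀ 1 / (D * T), by positivity,
    fun u hu ζ hζ ε' hε' ε hεε' hε p hp q hpq => ?_⟩
  have hε0 : 0 < ε := hε'.trans_le hεε'
  have hDT : D * T * ε ≤ min ε₀ 1 := (le_div_iff₀' (by positivity)).1 hε
  have hTε : T * ε ≤ min ε₀ 1 := by
    refine le_trans ?_ hDT
    rw [mul_assoc]
    exact le_mul_of_one_le_left (by positivity) hD
  have hpζ : p - ζ ∈ (n : ℝ) • growthBody r ζ (T * ε) :=
    smul_set_mono (growthBody_mono (by nlinarith))
      (sub_mem_smul_growthBody_of_mem_polydisc hr.convex hr.continuous hε'.le hp)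
  have hqp : q - p ∈ (1 : ℝ) • growthBody r ζ (T * ε) := by
    rw [one_smul]
    refine hball ζ hζ _ (hTε.trans (min_le_right _ _)) ?_
    rw [mem_closedBall_zero_iff, ← dist_eq_norm, dist_comm, le_div_iff₀' (by positivity)]
    calc L * dist p q ≤ L * (|B| * ε) := by
          gcongr
          exact hpq.trans (mul_le_mul_of_nonneg_right (le_abs_self B) hε0.le)
      _ ≤ T * ε := by simp only [T]; linarith
  have hqζ : q - ζ ∈ ((n : ℝ) + 1) • growthBody r ζ (T * ε) := by
    rw [(convex_growthBody hr.convex).add_smul n.cast_nonneg zero_le_one,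
      ← sub_add_sub_cancel' p ζ q]
    exact add_mem_add hpζ hqp
  obtain ⟨w, hw, hwq⟩ := hqζ
  refine hA ζ hζ _ (by positivity) (hDT.trans (min_le_right _ _)) u
    (hu ζ hζ _ (by positivity)) q ?_
  rw [← hwq, smul_smul, mul_assoc D]
  exact hscale ζ hζ _ (by positivity) (hTε.trans (min_le_left _ _)) w hw

/-! ### The gradient flow near the boundary -/

lemma exists_solution_mem_closedBall {E : Type*} [NormedAddCommGroup E] [NormedSpace ℝ E]
    [CompleteSpace E] {f : ℝ → E → E} {tmin tmax : ℝ} {t₀ : Icc tmin tmax} {x₀ x : E}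
    {a b L K : NNReal} (hf : IsPicardLindelof f t₀ x₀ a b L K) (hx : x ∈ Metric.closedBall x₀ b) :
    ∃ α : ℝ → E, Continuous α ∧ α t₀ = x ∧ (∀ t, α t ∈ Metric.closedBall x₀ a) ∧
      ∀ t ∈ Icc tmin tmax, HasDerivWithinAt α (f t (α t)) (Icc tmin tmax) t := by
  obtain ⟨α, hα⟩ := ODE.FunSpace.exists_isFixedPt_next hf hx
  have hmem : ∀ t, α.compProj t ∈ Metric.closedBall x₀ a :=
    fun t => α.compProj_mem_closedBall hf.mul_max_le
  have hpicard : ∀ t ∈ Icc tmin tmax, α.compProj t = ODE.picard f t₀ x α.compProj t := by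
    intro t ht
    nth_rw 1 [← hα]
    rw [ODE.FunSpace.compProj_of_mem ht, ODE.FunSpace.next_apply]
  refine ⟨α.compProj, α.continuous_compProj, ?_, hmem, fun t ht => ?_⟩
  · rw [hpicard t₀ t₀.2, ODE.picard_apply₀]
  · exact (ODE.hasDerivWithinAt_picard_Icc t₀.2 hf.continuousOn_uncurry
      α.continuous_compProj.continuousOn (fun s _ => hmem s) x ht).congr_of_mem hpicard ht

section NormalField

variable {F : Type*} [NormedAddCommGroup F] [InnerProductSpace ℝ F] [CompleteSpace F]
  {f : F → ℝ} {c T : ℝ} {z : F}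

/-- The field `∇f/|∇f|²`, along which `f` grows at unit speed. Division by zero makes it vanish at
the critical points of `f`. -/
def normalField (f : F → ℝ) (x : F) : F := (‖gradient f x‖ ^ 2)⁻¹ • gradient f x

lemma norm_normalField (f : F → ℝ) (x : F) : ‖normalField f x‖ = ‖gradient f x‖⁻¹ := by
  rw [normalField, norm_smul, norm_inv, norm_pow, norm_norm]
  rcases eq_or_ne ‖gradient f x‖ 0 with h | h
  · simp [h]
  · field_simp

lemma inner_gradient_normalField {x : F} (h : gradient f x ≠ 0) :
    inner ℝ (gradient f x) (normalField f x) = 1 := by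
  rw [normalField, real_inner_smul_right, real_inner_self_eq_norm_sq,
    inv_mul_cancel₀ (pow_ne_zero 2 (norm_ne_zero_iff.2 h))]

lemma exists_lipschitzOnWith_normalField (hf : ContDiff ℝ ∞ f) {s : Set F} (hs : IsCompact s)
    (hconv : Convex ℝ s) (hne : ∀ x ∈ s, gradient f x ≠ 0) :
    ∃ K, LipschitzOnWith K (normalField f) s := by
  have hgrad : ContDiffOn ℝ 1 (gradient f) s :=
    ((InnerProductSpace.toDual ℝ F).symm.contDiff.comp
      (hf.fderiv_right (m := 1) (by norm_cast))).contDiffOn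
  have hfield : ContDiffOn ℝ 1 (normalField f) s :=
    ((hgrad.norm_sq ℝ).inv fun x hx => by simpa using hne x hx).smul hgrad
  exact hfield.exists_lipschitzOnWith one_ne_zero hconv hs

lemma apply_eq_add_of_hasDerivWithinAt_normalField (hf : Differentiable ℝ f) {β : ℝ → F}
    (hβ : ∀ t ∈ Icc 0 T, HasDerivWithinAt β (normalField f (β t)) (Icc 0 T) t)
    (hne : ∀ t ∈ Icc 0 T, gradient f (β t) ≠ 0) {t : ℝ} (ht : t ∈ Icc 0 T) :
    f (β t) = f (β 0) + t := by
  have hcont : ContinuousOn (fun s => f (β s) - s) (Icc 0 T) :=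
    (hf.continuous.comp_continuousOn fun s hs => (hβ s hs).continuousWithinAt).sub continuousOn_id
  have hderiv : ∀ s ∈ Ico 0 T, HasDerivWithinAt (fun s => f (β s) - s) 0 (Ici s) s := by
    intro s hs
    have hs' := Ico_subset_Icc_self hs
    have h : HasFDerivAt f (innerSL ℝ (gradient f (β s))) (β s) := (hf (β s)).hasGradientAt
    have hsub := (h.comp_hasDerivWithinAt s (hβ s hs')).sub (hasDerivWithinAt_id s (Icc 0 T))
    rw [innerSL_apply_apply, inner_gradient_normalField (hne s hs'), sub_self] at hsub
    exact hsub.mono_of_mem_nhdsWithin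
      (mem_of_superset (Icc_mem_nhdsGE hs.2) (Icc_subset_Icc_left hs.1))
  have hconst : f (β t) - t = f (β 0) - 0 := constant_of_has_deriv_right_zero hcont hderiv t ht
  linarith

lemma exists_gradient_ascent [ProperSpace F] (hf : ContDiff ℝ ∞ f) (hc : 0 < c) (hT : 0 ≤ T)
    (hgrad : ∀ x ∈ Metric.closedBall z (T / c), c ≤ ‖gradient f x‖) :
    ∃ β : ℝ → F, Continuous β ∧ β 0 = z ∧ (∀ t, β t ∈ Metric.closedBall z (T / c)) ∧
      (∀ t ∈ Icc 0 T, HasDerivWithinAt β (normalField f (β t)) (Icc 0 T) t) ∧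
      ∀ t ∈ Icc 0 T, f (β t) = f z + t := by
  lift c to NNReal using hc.le
  lift T to NNReal using hT
  have hne : ∀ x ∈ Metric.closedBall z (T / c), gradient f x ≠ 0 := fun x hx =>
    norm_pos_iff.1 (hc.trans_le (hgrad x hx))
  obtain ⟨K, hK⟩ := exists_lipschitzOnWith_normalField hf (isCompact_closedBall _ _)
    (convex_closedBall _ _) hne
  have hspeed : ∀ x ∈ Metric.closedBall z (T / c), ‖normalField f x‖ ≤ (c⁻¹ : NNReal) := by
    intro x hx
    rw [norm_normalField, NNReal.coe_inv]
    exact inv_anti₀ hc (hgrad x hx)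
  obtain ⟨β, hβc, hβ0, hβmem, hβ⟩ := exists_solution_mem_closedBall (a := T / c) (b := 0)
    (t₀ := (⟨0, le_rfl, T.2⟩ : Icc (0 : ℝ) T))
    (IsPicardLindelof.of_time_independent hspeed hK
      (by simp [div_eq_inv_mul])) (Metric.mem_closedBall_self le_rfl)
  refine ⟨β, hβc, hβ0, hβmem, hβ, fun t ht => ?_⟩
  rw [apply_eq_add_of_hasDerivWithinAt_normalField (hf.differentiable (by simp)) hβ
    (fun s _ => hne _ (hβmem s)) ht]
  exact congrArg (f · + t) hβ0

end NormalField

section Flow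

variable {r : Cn n → ℝ} {U V : Set (Cn n)} {t₀ c : ℝ} {φ : Cn n → ℝ → Cn n}

lemma mem_bd_iff (hr : Continuous r) {z : Cn n} : z ∈ bd r ↔ z ∈ closure (dom r) ∧ 0 ≤ r z := by
  have hopen : IsOpen (dom r) := isOpen_lt hr continuous_const
  rw [bd, hopen.frontier_eq, Set.mem_sdiff, dom, mem_ofPred_eq, not_lt]

lemma IsBoundedConvex.exists_forall_dist_bd_lt (hr : IsBoundedConvex r) {δ : ℝ} (hδ : 0 < δ) :
    ∃ τ > 0, ∀ z ∈ dom r, -τ < r z → ∃ p ∈ bd r, dist z p < δ := by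
  let K := closure (dom r) \ Metric.thickening δ (bd r)
  have hK : IsCompact K := hr.bounded.isCompact_closure.diff Metric.isOpen_thickening
  have hneg : ∀ z ∈ K, r z < 0 := by
    intro z hz
    by_contra! h0
    exact hz.2 (Metric.self_subset_thickening hδ _ ((mem_bd_iff hr.continuous).2 ⟨hz.1, h0⟩))
  obtain ⟨τ, hτ, hKτ⟩ : ∃ τ > 0, ∀ z ∈ K, r z ≤ -τ := by
    rcases K.eq_empty_or_nonempty with hempty | hne
    · exact ⟨1, one_pos, by simp [hempty]⟩
    · obtain ⟨y, hy, hmax⟩ := hK.exists_isMaxOn hne hr.continuous.continuousOn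
      exact ⟨-r y, neg_pos.2 (hneg y hy), fun z hz => (hmax hz).trans_eq (neg_neg _).symm⟩
  refine ⟨τ, hτ, fun z hz hzτ => Metric.mem_thickening_iff.1 ?_⟩
  by_contra hthick
  exact hzτ.not_ge (hKτ z ⟨subset_closure hz, hthick⟩)

lemma IsBoundedConvex.exists_forall_closedBall_subset (hr : IsBoundedConvex r)
    (hV : V ∈ 𝓝ˢ (bd r)) (b : ℝ) :
    ∃ τ > 0, ∀ z ∈ dom r, -τ < r z → Metric.closedBall z (b * -r z) ⊆ V := by
  obtain ⟨δ, hδ, hδV⟩ := hr.isCompact_bd.exists_cthickening_subset_open isOpen_interior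
    (subset_interior_iff_mem_nhdsSet.2 hV)
  obtain ⟨τ, hτ, hnear⟩ := hr.exists_forall_dist_bd_lt (half_pos hδ)
  refine ⟨min τ (δ / 2 / (|b| + 1)), by positivity, fun z hz hzτ x hx => ?_⟩
  obtain ⟨p, hp, hzp⟩ := hnear z hz (by linarith [min_le_left τ (δ / 2 / (|b| + 1))])
  have hrz : -r z * (|b| + 1) ≤ δ / 2 :=
    (le_div_iff₀ (by positivity)).1 (by linarith [min_le_right τ (δ / 2 / (|b| + 1))])
  have hradius : b * -r z ≤ δ / 2 := by
    have hneg : 0 < -r z := neg_pos.2 hz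
    nlinarith [le_abs_self b]
  refine interior_subset (hδV (Metric.mem_cthickening_of_dist_le x p δ _ hp ?_))
  linarith [dist_triangle x z p, Metric.mem_closedBall.1 hx]

lemma IsNormalFlow.hasDerivWithinAt_Ici (hφ : IsNormalFlow r U V t₀ φ) {x : Cn n} (hx : x ∈ V)
    {t : ℝ} (ht : t ∈ Ico 0 t₀) :
    HasDerivWithinAt (φ x) (-normalField r (φ x t)) (Ici t) t :=
  (hφ.ode x hx t ht).mono_of_mem_nhdsWithin
    (mem_of_superset (Ico_mem_nhdsGE ht.2) (Ico_subset_Ico_left ht.1))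

lemma IsNormalFlow.dist_le (hφ : IsNormalFlow r U V t₀ φ) (hc : 0 < c)
    (hgrad : ∀ z ∈ U, c ≤ ‖gradient r z‖) {x : Cn n} (hx : x ∈ V) {t : ℝ} (ht : t ∈ Ico 0 t₀) :
    dist (φ x t) x ≤ t / c := by
  have hmem : Icc 0 t ⊆ Ico 0 t₀ := Icc_subset_Ico_right ht.2
  have hspeed : ∀ s ∈ Ico 0 t, ‖-normalField r (φ x s)‖ ≤ c⁻¹ := by
    intro s hs
    rw [norm_neg, norm_normalField]
    exact inv_anti₀ hc (hgrad _ (hφ.mem x hx s (hmem (Ico_subset_Icc_self hs))))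
  have hdist := norm_image_sub_le_of_norm_deriv_le_segment'
    (fun s hs => (hφ.ode x hx s (hmem hs)).mono hmem) hspeed t (right_mem_Icc.2 ht.1)
  rwa [hφ.init x hx, sub_zero, ← dist_eq_norm, inv_mul_eq_div] at hdist

lemma IsNormalFlow.apply_eq_of_gradient_ascent (hφ : IsNormalFlow r U V t₀ φ) {K : NNReal}
    {s : Set (Cn n)} (hs : LipschitzOnWith K (normalField r) s) {T : ℝ} (hT : T ∈ Ico 0 t₀)
    {β : ℝ → Cn n} (hβmem : ∀ t ∈ Icc 0 T, β t ∈ s)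
    (hβ : ∀ t ∈ Icc 0 T, HasDerivWithinAt β (normalField r (β t)) (Icc 0 T) t)
    (hβV : β T ∈ V) (hφmem : ∀ t ∈ Ico 0 T, φ (β T) t ∈ s) : φ (β T) T = β 0 := by
  have hsub : Icc 0 T ⊆ Ico 0 t₀ := Icc_subset_Ico_right hT.2
  have hmaps : MapsTo (fun t : ℝ => T - t) (Icc 0 T) (Icc 0 T) :=
    fun t ht => ⟨sub_nonneg.2 ht.2, sub_le_self T ht.1⟩
  have hreverse : ∀ t ∈ Icc 0 T,
      HasDerivWithinAt (fun t => β (T - t)) (-normalField r (β (T - t))) (Icc 0 T) t := by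
    intro t ht
    have h := (hβ (T - t) (hmaps ht)).scomp t ((hasDerivWithinAt_id t _).const_sub T) hmaps
    rwa [neg_one_smul] at h
  have huniq : EqOn (φ (β T)) (fun t => β (T - t)) (Icc 0 T) :=
    ODE_solution_unique_of_mem_Icc_right (v := fun _ x => -normalField r x) (s := fun _ => s)
      (fun _ _ => hs.neg)
      (fun t ht => (hφ.ode _ hβV t (hsub ht)).continuousWithinAt.mono hsub)
      (fun t ht => hφ.hasDerivWithinAt_Ici hβV (hsub (Ico_subset_Icc_self ht)))
      hφmem
      (fun t ht => (hreverse t ht).continuousWithinAt)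
      (fun t ht => (hreverse t (Ico_subset_Icc_self ht)).mono_of_mem_nhdsWithin
        (mem_of_superset (Icc_mem_nhdsGE ht.2) (Icc_subset_Icc_left ht.1)))
      (fun t ht => hβmem _ (hmaps (Ico_subset_Icc_self ht)))
      (by simp [hφ.init _ hβV])
  simpa using huniq (right_mem_Icc.2 hT.1)

lemma IsNormalFlow.exists_isFlowProj (hφ : IsNormalFlow r U V t₀ φ) (hr : ContDiff ℝ ∞ r)
    (hc : 0 < c) (hgrad : ∀ z ∈ U, c ≤ ‖gradient r z‖) {z : Cn n} (hz : z ∈ dom r)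
    (hzt₀ : -r z < t₀) (hball : Metric.closedBall z (2 * (-r z / c)) ⊆ V) :
    ∃ q, IsFlowProj r t₀ φ z q := by
  set T := -r z
  have hT : 0 < T := neg_pos.2 hz
  have hTc : 0 < T / c := div_pos hT hc
  have hgrad' : ∀ x ∈ Metric.closedBall z (2 * (T / c)), c ≤ ‖gradient r x‖ :=
    fun x hx => hgrad x (hφ.sub (hball hx))
  have hhalf : Metric.closedBall z (T / c) ⊆ Metric.closedBall z (2 * (T / c)) :=
    Metric.closedBall_subset_closedBall (by linarith)
  obtain ⟨K, hK⟩ := exists_lipschitzOnWith_normalField hr (isCompact_closedBall z (2 * (T / c)))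
    (convex_closedBall _ _) fun x hx => norm_pos_iff.1 (hc.trans_le (hgrad' x hx))
  obtain ⟨β, hβc, hβ0, hβmem, hβ, hlevel⟩ := exists_gradient_ascent hr hc hT.le
    fun x hx => hgrad' x (hhalf hx)
  have hclosure : β T ∈ closure (dom r) := by
    have hmaps : MapsTo β (Ico 0 T) (dom r) := fun t ht => by
      change r (β t) < 0
      linarith [hlevel t (Ico_subset_Icc_self ht), ht.2]
    refine hmaps.closure hβc ?_
    rw [closure_Ico hT.ne]
    exact right_mem_Icc.2 hT.le
  have hbd : β T ∈ bd r := (mem_bd_iff hr.continuous).2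
    ⟨hclosure, by linarith [hlevel T (right_mem_Icc.2 hT.le)]⟩
  have hV : β T ∈ V := subset_of_mem_nhdsSet hφ.nhd hbd
  have hT₀ : T ∈ Ico 0 t₀ := ⟨hT.le, hzt₀⟩
  have hflow : ∀ t ∈ Ico 0 T, φ (β T) t ∈ Metric.closedBall z (2 * (T / c)) := by
    intro t ht
    have hle : dist (φ (β T) t) (β T) ≤ T / c :=
      (hφ.dist_le hc hgrad hV ⟨ht.1, ht.2.trans hzt₀⟩).trans (by gcongr; exact ht.2.le)
    rw [Metric.mem_closedBall]
    linarith [dist_triangle (φ (β T) t) (β T) z, Metric.mem_closedBall.1 (hβmem T)]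
  exact ⟨β T, hbd, hT₀, (hφ.apply_eq_of_gradient_ascent hK hT₀
    (fun t _ => hhalf (hβmem t)) hβ hV hflow).trans hβ0⟩

lemma IsNormalFlow.dist_isNearest_isFlowProj_le (hφ : IsNormalFlow r U V t₀ φ) (hc : 0 < c)
    (hgrad : ∀ z ∈ U, c ≤ ‖gradient r z‖) {z p q : Cn n} (hp : IsNearest r z p)
    (hq : IsFlowProj r t₀ φ z q) : dist p q ≤ 2 / c * -r z := by
  have hzq : dist z q ≤ -r z / c := by
    simpa only [hq.2.2] using hφ.dist_le hc hgrad (subset_of_mem_nhdsSet hφ.nhd hq.1) hq.2.1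
  have hzp : dist z p ≤ dist z q := hp.2.trans_le (Metric.infDist_le_dist_of_mem hq.1)
  calc dist p q ≤ dist z p + dist z q := dist_triangle_left p q z
    _ ≤ -r z / c + -r z / c := add_le_add (hzp.trans hzq) hzq
    _ = 2 / c * -r z := by ring

lemma IsBoundedConvex.exists_forall_isFlowProj (hr : IsBoundedConvex r) (hc : 0 < c)
    (hgrad : ∀ z ∈ U, c ≤ ‖gradient r z‖) (hV : V ∈ 𝓝ˢ (bd r)) (ht₀ : 0 < t₀) :
    ∃ τ > 0, ∀ φ, IsNormalFlow r U V t₀ φ → ∀ z ∈ dom r, -τ < r z →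
      z ∈ V ∧ ∃ q, IsFlowProj r t₀ φ z q := by
  obtain ⟨τ, hτ, hball⟩ := hr.exists_forall_closedBall_subset hV (2 / c)
  refine ⟨min τ t₀, lt_min hτ ht₀, fun φ hφ z hz hzτ => ?_⟩
  have hzV := hball z hz (by linarith [min_le_left τ t₀])
  have hneg : 0 < -r z := neg_pos.2 hz
  refine ⟨hzV (Metric.mem_closedBall_self (by positivity)),
    hφ.exists_isFlowProj hr.smooth hc hgrad hz (by linarith [min_le_right τ t₀]) ?_⟩
  rwa [mul_div_left_comm, mul_comm]

end Flow

/-! ### Tents -/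

section Tents

variable {r : Cn n → ℝ} {U V S S' : Set (Cn n)} {t₀ c s s' : ℝ} {φ : Cn n → ℝ → Cn n}

lemma IsNormalFlow.flowTent_subset_projTent (hφ : IsNormalFlow r U V t₀ φ)
    (hbd : IsCompact (bd r)) (hc : 0 < c) (hgrad : ∀ z ∈ U, c ≤ ‖gradient r z‖) (hs : s ≤ s')
    (hS : ∀ q ∈ S, ∀ p ∈ bd r, dist p q ≤ 2 / c * s → p ∈ S') :
    flowTent r V t₀ φ S s ⊆ projTent r U (S' ∩ bd r) s' := by
  rintro z ⟨⟨hz, hzV⟩, ⟨q, hqS, hq⟩, hrz⟩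
  obtain ⟨p, hp, hpz⟩ := hbd.exists_infDist_eq_dist ⟨q, hq.1⟩ z
  have hnearest : IsNearest r z p := ⟨hp, hpz.symm⟩
  have hpq : dist p q ≤ 2 / c * s :=
    (hφ.dist_isNearest_isFlowProj_le hc hgrad hnearest hq).trans
      (by gcongr; linarith [hrz.1])
  exact ⟨⟨hz, hφ.sub hzV⟩, ⟨p, ⟨hS q hqS p hp hpq, hp⟩, hnearest⟩,
    Ioo_subset_Ioo_left (neg_le_neg hs) hrz⟩

lemma IsNormalFlow.projTent_subset_flowTent (hφ : IsNormalFlow r U V t₀ φ) (hc : 0 < c)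
    (hgrad : ∀ z ∈ U, c ≤ ‖gradient r z‖)
    (hproj : ∀ z ∈ dom r, -s < r z → z ∈ V ∧ ∃ q, IsFlowProj r t₀ φ z q) (hs : s ≤ s')
    (hS : ∀ p ∈ S, ∀ q ∈ bd r, dist q p ≤ 2 / c * s → q ∈ S') :
    projTent r U S s ⊆ flowTent r V t₀ φ (S' ∩ bd r) s' := by
  rintro z ⟨⟨hz, -⟩, ⟨p, hpS, hp⟩, hrz⟩
  obtain ⟨hzV, q, hq⟩ := hproj z hz hrz.1
  have hqp : dist q p ≤ 2 / c * s := by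
    rw [dist_comm]
    exact (hφ.dist_isNearest_isFlowProj_le hc hgrad hp hq).trans
      (by gcongr; linarith [hrz.1])
  exact ⟨⟨hz, hzV⟩, ⟨q, ⟨hS p hpS q hq.1 hqp, hq.1⟩, hq⟩,
    Ioo_subset_Ioo_left (neg_le_neg hs) hrz⟩

lemma IsBoundedConvex.exists_tent_comparison (hr : IsBoundedConvex r) {M : ℕ}
    (hM : domainType r ≤ M) (hc : 0 < c) :
    ∃ C₁ > 1, ∀ U V t₀, (∀ z ∈ U, c ≤ ‖gradient r z‖) → ∃ τ > 0, ∀ φ u,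
      IsNormalFlow r U V t₀ φ → IsExtremalChoice r u → ∀ ζ ∈ bd r, ∀ ε ∈ Ioc 0 τ, ∀ s ≤ ε, ∀ S,
        (∀ p ∈ S, ∃ ε' ∈ Ioc 0 ε, p ∈ polydisc r u ζ ε') →
          flowTent r V t₀ φ S s ⊆ projTentAt r u U ζ (C₁ * ε) ∧
          projTent r U S s ⊆ flowTentAt r u V t₀ φ ζ (C₁ * ε) := by
  obtain ⟨C₁, hC₁, ε₁, hε₁, hengulf⟩ := hr.exists_engulfing hM (2 / c)
  refine ⟨C₁, hC₁, fun U V t₀ hgrad => ?_⟩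
  by_cases hV : V ∈ 𝓝ˢ (bd r) ∧ 0 < t₀
  swap
  · exact ⟨1, one_pos, fun φ u hφ => absurd ⟨hφ.nhd, hφ.time_pos⟩ hV⟩
  obtain ⟨τ, hτ, hproj⟩ := hr.exists_forall_isFlowProj hc hgrad hV.1 hV.2
  refine ⟨min τ ε₁, lt_min hτ hε₁, fun φ u hφ hu ζ hζ ε hε s hs S hS => ?_⟩
  have hnear : ∀ p ∈ S, ∀ q ∈ bd r, dist q p ≤ 2 / c * s → q ∈ polydisc r u ζ (C₁ * ε) := by
    intro p hp q _ hqp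
    obtain ⟨ε', hε', hpε'⟩ := hS p hp
    refine hengulf u hu ζ hζ ε' hε'.1 ε hε'.2 (hε.2.trans (min_le_right _ _)) p hpε' q ?_
    rw [dist_comm]
    exact hqp.trans (by gcongr)
  have hheight : s ≤ C₁ * ε := hs.trans (le_mul_of_one_le_left hε.1.le hC₁.le)
  exact ⟨hφ.flowTent_subset_projTent hr.isCompact_bd hc hgrad hheight hnear,
    hφ.projTent_subset_flowTent hc hgrad
      (fun z hz hzs => hproj φ hφ z hz (by linarith [hε.2, min_le_left τ ε₁])) hheight hnear⟩

lemma IsDyadicGrid.exists_mem_polydisc {u : Cn n → ℝ → Fin n → Cn n}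
    {D : ℕ → Set (Set (Cn n))} {c : ℕ → Set (Cn n) → Cn n} {C δ ϵ : ℝ}
    (hD : IsDyadicGrid r u D c C δ ϵ) {k : ℕ} (hk : 1 ≤ k) {Q : Set (Cn n)} (hQ : Q ∈ D k)
    {q : Cn n} (hq : q ∈ Q) : ∃ ε' ∈ Ioc 0 (C * δ ^ k), q ∈ polydisc r u (c k Q) ε' := by
  have hrho : rho r u q (c k Q) < ENNReal.ofReal (C * δ ^ k) := ((hD.sandwich k hk Q hQ).2 hq).2
  simp only [rho, iInf_lt_iff] at hrho
  obtain ⟨ε', ⟨hε', hqε', -⟩, hlt⟩ := hrho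
  exact ⟨ε', ⟨hε', (ENNReal.ofReal_lt_ofReal_iff'.1 hlt).1.le⟩, hqε'⟩

end Tents

end FlowTents

end

open FlowTents in
theorem theorem3p4_general {n : ℕ} {r : Cn n → ℝ} {c : ℝ} (hr : IsBoundedConvex r)
    (hM : domainType r ≠ ⊤) (hc : 0 < c) :
    ∃ C₁ : ℝ, 1 < C₁ ∧
      ∀ (U V : Set (Cn n)) (t₀ : ℝ), (∀ z ∈ U, c ≤ ‖gradient r z‖) →
        ∃ τ₂ : ℝ, 0 < τ₂ ∧
          ∀ (φ : Cn n → ℝ → Cn n) (u : Cn n → ℝ → Fin n → Cn n),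
            IsNormalFlow r U V t₀ φ → IsExtremalChoice r u →
            (∀ ε : ℝ, 0 < ε → ε < τ₂ → ∀ ζ ∈ bd r,
              flowTentAt r u V t₀ φ ζ ε ⊆ projTentAt r u U ζ (C₁ * ε) ∧
              projTentAt r u U ζ ε ⊆ flowTentAt r u V t₀ φ ζ (C₁ * ε)) ∧
            (∀ (D : ℕ → Set (Set (Cn n))) (c : ℕ → Set (Cn n) → Cn n) (C δ ϵ : ℝ),
              IsDyadicGrid r u D c C δ ϵ →
              ∀ k, 1 ≤ k → ∀ Q ∈ D k, δ ^ k ≤ τ₂ / C →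
                projTent r U Q (δ ^ k) ⊆ flowTentAt r u V t₀ φ (c k Q) (C * C₁ * δ ^ k) ∧
                flowTent r V t₀ φ Q (δ ^ k) ⊆ projTentAt r u U (c k Q) (C * C₁ * δ ^ k)) := by
  obtain ⟨M, hM⟩ := ENat.ne_top_iff_exists.1 hM
  obtain ⟨C₁, hC₁, htents⟩ := hr.exists_tent_comparison hM.ge hc
  refine ⟨C₁, hC₁, fun U V t₀ hgrad => ?_⟩
  obtain ⟨τ₂, hτ₂, htents⟩ := htents U V t₀ hgrad
  refine ⟨τ₂, hτ₂, fun φ u hφ hu => ⟨fun ε hε hετ ζ hζ => ?_,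
    fun D c C δ ϵ hD k hk Q hQ hδ => ?_⟩⟩
  · have hpolydisc : ∀ p ∈ polydisc r u ζ ε ∩ bd r, ∃ ε' ∈ Ioc 0 ε, p ∈ polydisc r u ζ ε' :=
      fun p hp => ⟨ε, right_mem_Ioc.2 hε, hp.1⟩
    exact htents φ u hφ hu ζ hζ ε ⟨hε, hετ.le⟩ ε le_rfl _ hpolydisc
  · have hC : 0 < C := one_pos.trans hD.one_lt_C
    have hδk : 0 < δ ^ k := pow_pos hD.δ_pos k
    have hscale : C * δ ^ k ∈ Ioc 0 τ₂ := ⟨mul_pos hC hδk, (le_div_iff₀' hC).1 hδ⟩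
    rw [mul_comm C C₁, mul_assoc]
    exact (htents φ u hφ hu (c k Q) (hD.center_mem k hk Q hQ) _ hscale (δ ^ k)
      (le_mul_of_one_le_left hδk.le hD.one_lt_C.le) Q
      fun q hq => hD.exists_mem_polydisc hk hQ hq).symm

open FlowTents in
theorem theorem3p4 (n M : ℕ) (hn : 1 < n) (r : Cn n → ℝ) (hr : IsConvexFiniteType r M) :
    ∃ C₁ : ℝ, 1 < C₁ ∧
      ∀ (U V : Set (Cn n)) (t₀ : ℝ), IsAdmissibleNhd r U →
        ∃ τ₂ : ℝ, 0 < τ₂ ∧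
          ∀ (φ : Cn n → ℝ → Cn n) (u : Cn n → ℝ → Fin n → Cn n),
            IsNormalFlow r U V t₀ φ → IsExtremalChoice r u →
            (∀ ε : ℝ, 0 < ε → ε < τ₂ → ∀ ζ ∈ bd r,
              flowTentAt r u V t₀ φ ζ ε ⊆ projTentAt r u U ζ (C₁ * ε) ∧
              projTentAt r u U ζ ε ⊆ flowTentAt r u V t₀ φ ζ (C₁ * ε)) ∧
            (∀ (D : ℕ → Set (Set (Cn n))) (c : ℕ → Set (Cn n) → Cn n) (C δ ϵ : ℝ),
              IsDyadicGrid r u D c C δ ϵ →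
              ∀ k, 1 ≤ k → ∀ Q ∈ D k, δ ^ k ≤ τ₂ / C →
                projTent r U Q (δ ^ k) ⊆ flowTentAt r u V t₀ φ (c k Q) (C * C₁ * δ ^ k) ∧
                flowTent r V t₀ φ Q (δ ^ k) ⊆ projTentAt r u U (c k Q) (C * C₁ * δ ^ k)) := by
  have htype : domainType r ≠ ⊤ := hr.type_eq ▸ ENat.natCast_ne_top M
  obtain ⟨C₁, hC₁, htents⟩ := theorem3p4_general
    ⟨hr.smooth, hr.convex, hr.nonempty, hr.bounded⟩ htype (c := 2 / 3) (by norm_num)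
  exact ⟨C₁, hC₁, fun U V t₀ hU => htents U V t₀ fun z hz => (hU.grad z hz).1⟩
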